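/- Let $N\ge 2$, $\mu>0$, $\omega>0$, and let $\mathcal G$ be the star graph made of $N$ half-lines $[0,\infty)$ joined at their origins. Let $\mathcal E$ be the space of all $\Psi=(\psi_1,\dots,\psi_N)$ with $\psi_i\in H^1(\mathbb R^+;\mathbb C)$ and $\psi_1(0)=\dots=\psi_N(0)$, with the $H^1$ norm $\|\Psi\|_{H^1}^2=\sum_i\left(\|\psi_i\|_{L^2(\mathbb R^+)}^2+\|\psi_i'\|_{L^2(\mathbb R^+)}^2\right)$. Write $\|\Psi\|_r^r=\sum_i\|\psi_i\|_{L^r(\mathbb R^+)}^r$ and $\|\cdot\|=\|\cdot\|_2$. For the Kirchhoff vertex (no point interaction, $\alpha=0$) put $$S^0_\omega[\Psi]=\tfrac12\|\Psi'\|^2+\tfrac{\omega}{2}\|\Psi\|^2-\tfrac1{2\mu+2}\|\Psi\|_{2\mu+2}^{2\mu+2},\qquad I^0_\omega[\Psi]=\|\Psi'\|^2-\|\Psi\|_{2\mu+2}^{2\mu+2}+\omega\|\Psi\|^2 .$$ (1) The infimum of the action on the Nehari manifold is $$\inf\{S^0_\omega[\Psi] : \Psi\in\mathcal E,\ \Psi\neq0,\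 I^0_\omega[\Psi]=0\}=d^0(\omega):=(\mu+1)^{1/\mu}\,\omega^{1/\mu+1/2}\int_0^1(1-t^2)^{1/\mu}\,dt .$$ (2) It equals the action of the line soliton $\phi_s(x)=[(\mu+1)\omega]^{1/(2\mu)}\operatorname{sech}^{1/\mu}(\mu\sqrt\omega\,x)$: this function is continuously differentiable, $\phi_s$ and $\phi_s'$ are in $L^2(\mathbb R)$, $\phi_s\in L^{2\mu+2}(\mathbb R)$, and $$\tfrac12\|\phi_s'\|_{L^2(\mathbb R)}^2+\tfrac\omega2\|\phi_s\|_{L^2(\mathbb R)}^2-\tfrac1{2\mu+2}\|\phi_s\|_{L^{2\mu+2}(\mathbb R)}^{2\mu+2}=d^0(\omega).$$ (3) The infimum is approximated by solitons escaping to infinity along one edge. Let $\chi\in C^\infty([0,\infty))$ with $0\le\chi\le1$, $\chi=0$ on $[0,1]$ and $\chi=1$ on $[2,\infty)$, and let $j$ be any edge. For $n=0,1,2,\dots$ let $\Phi_n$ have the component $\phi_s(x-n)\chi(x)$ on the edge $j$ and $0$ on all other edges, and put $$\delta_n=\left(\frac{\|\Phi_n'\|^2+\omega\|\Phi_n\|^2}{\|\Phi_n\|_{2\mu+2}^{2\mu+2}}\right)^{1/(2\mu)}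 .$$ Then $\Phi_n\in\mathcal E$, $\delta_n\Phi_n\ne0$, $I^0_\omega[\delta_n\Phi_n]=0$, $\delta_n\to1$, $S^0_\omega[\delta_n\Phi_n]\to d^0(\omega)$, and $\delta_n\Phi_n$ converges to $0$ weakly in $\mathcal E$ as $n\to\infty$. -/

import Mathlib

open Set Filter Topology MeasureTheory
open scoped ENNReal

namespace StarGraph

noncomputable section

/-- The complex Hilbert space `L²(ℝ⁺)`. -/
abbrev L2Half : Type := Lp ℂ 2 (volume.restrict (Ioi (0 : ℝ)))

/-- `v` is the weak derivative of `u` on the open half-line `(0, ∞)`: integration by parts holds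
against every smooth function with compact support in `(0, ∞)`. -/
def IsWeakDeriv (u v : ℝ → ℂ) : Prop :=
  ∀ φ : ℝ → ℝ, ContDiff ℝ (⊤ : ℕ∞) φ → HasCompactSupport φ → tsupport φ ⊆ Ioi 0 →
    ∫ x in Ioi (0 : ℝ), deriv φ x • u x = - ∫ x in Ioi (0 : ℝ), φ x • v x

theorem integrable_smul_of_test {φ : ℝ → ℝ} (hφ : Continuous φ) (hc : HasCompactSupport φ)
    (u : L2Half) : Integrable (fun x => φ x • u x) (volume.restrict (Ioi (0 : ℝ))) :=
  memLp_one_iff_integrable.1 <| MemLp.smul (p := 2) (q := 2) (r := 1) (Lp.memLp u)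
    ((hφ.memLp_of_hasCompactSupport hc (μ := volume) (p := 2)).restrict _)

/-- The Sobolev space `H¹(ℝ⁺)`, realised as the space of the pairs `(u, u')` in
`L²(ℝ⁺) × L²(ℝ⁺)` such that `u'` is the weak derivative of `u`. Its norm is the one inherited from
the Hilbert sum, `‖u‖²_{H¹} = ‖u‖² + ‖u'‖²`. -/
def H1Half : Submodule ℂ (WithLp 2 (L2Half × L2Half)) where
  carrier := {p | IsWeakDeriv p.fst p.snd}
  zero_mem' := by
    intro φ _ _ _
    have h0 : ((0 : L2Half) : ℝ → ℂ) =ᵐ[volume.restrict (Ioi (0 : ℝ))] 0 := Lp.coeFn_zero _ _ _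
    have h1 : ∫ x in Ioi (0 : ℝ), deriv φ x • (0 : L2Half) x = 0 :=
      integral_eq_zero_of_ae (by filter_upwards [h0] with x hx; rw [hx, Pi.zero_apply, smul_zero])
    have h2 : ∫ x in Ioi (0 : ℝ), φ x • (0 : L2Half) x = 0 :=
      integral_eq_zero_of_ae (by filter_upwards [h0] with x hx; rw [hx, Pi.zero_apply, smul_zero])
    simp only [WithLp.zero_fst, WithLp.zero_snd]
    rw [h1, h2, neg_zero]
  add_mem' := by
    intro p q hp hq φ h1 h2 h3
    have hd : Continuous (deriv φ) := h1.continuous_deriv (by simp)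
    have e1 : ∫ x in Ioi (0 : ℝ), deriv φ x • (p + q).fst x
        = (∫ x in Ioi (0 : ℝ), deriv φ x • p.fst x) + ∫ x in Ioi (0 : ℝ), deriv φ x • q.fst x := by
      rw [← integral_add (integrable_smul_of_test hd h2.deriv _)
        (integrable_smul_of_test hd h2.deriv _)]
      apply integral_congr_ae
      filter_upwards [Lp.coeFn_add p.fst q.fst] with x hx
      rw [WithLp.add_fst, hx, Pi.add_apply, smul_add]
    have e2 : ∫ x in Ioi (0 : ℝ), φ x • (p + q).snd x
        = (∫ x in Ioi (0 : ℝ), φ x • p.snd x) + ∫ x in Ioi (0 : ℝ), φ x • q.snd x := by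
      rw [← integral_add (integrable_smul_of_test h1.continuous h2 _)
        (integrable_smul_of_test h1.continuous h2 _)]
      apply integral_congr_ae
      filter_upwards [Lp.coeFn_add p.snd q.snd] with x hx
      rw [WithLp.add_snd, hx, Pi.add_apply, smul_add]
    rw [e1, e2, hp φ h1 h2 h3, hq φ h1 h2 h3, neg_add]
  smul_mem' := by
    intro c p hp φ h1 h2 h3
    have e1 : ∫ x in Ioi (0 : ℝ), deriv φ x • (c • p).fst x
        = c • ∫ x in Ioi (0 : ℝ), deriv φ x • p.fst x := by
      rw [← integral_smul]
      apply integral_congr_ae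
      filter_upwards [Lp.coeFn_smul c p.fst] with x hx
      rw [WithLp.smul_fst, hx, Pi.smul_apply, smul_comm]
    have e2 : ∫ x in Ioi (0 : ℝ), φ x • (c • p).snd x
        = c • ∫ x in Ioi (0 : ℝ), φ x • p.snd x := by
      rw [← integral_smul]
      apply integral_congr_ae
      filter_upwards [Lp.coeFn_smul c p.snd] with x hx
      rw [WithLp.smul_snd, hx, Pi.smul_apply, smul_comm]
    rw [e1, e2, hp φ h1 h2 h3, smul_neg]

/-- The underlying `L²` function of an element of `H¹(ℝ⁺)`. -/
def val (u : H1Half) : L2Half := (u : WithLp 2 (L2Half × L2Half)).fst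

/-- The weak derivative of an element of `H¹(ℝ⁺)`. -/
def der (u : H1Half) : L2Half := (u : WithLp 2 (L2Half × L2Half)).snd

/-- The boundary value `u(0)` is `c`: the representative of `u` that is continuous on `[0, ∞)`
takes the value `c` at `0`. -/
def HasValueAtZero (u : H1Half) (c : ℂ) : Prop :=
  ∃ f : ℝ → ℂ, ContinuousOn f (Ici 0) ∧ val u =ᵐ[volume.restrict (Ioi (0 : ℝ))] f ∧ f 0 = c

/-- `H¹(𝒢)` for the star graph `𝒢` with `N` half-lines: the Hilbert sum of `N` copies of
`H¹(ℝ⁺)`. -/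
abbrev H1Graph (N : ℕ) : Type := PiLp 2 (fun _ : Fin N => H1Half)

/-- The finite energy space `ℰ` of the elements of `H¹(𝒢)` that are continuous at the vertex,
`ψ₁(0) = ⋯ = ψ_N(0)`, with the `H¹` norm. -/
def EnergySpace (N : ℕ) : Submodule ℂ (H1Graph N) where
  carrier := {Ψ | ∃ c : ℂ, ∀ i, HasValueAtZero (Ψ i) c}
  zero_mem' := ⟨0, fun _ => ⟨0, continuousOn_const, Lp.coeFn_zero _ _ _, rfl⟩⟩
  add_mem' := by
    rintro Ψ Φ ⟨c, hc⟩ ⟨d, hd⟩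
    refine ⟨c + d, fun i => ?_⟩
    obtain ⟨f, f1, f2, f3⟩ := hc i
    obtain ⟨g, g1, g2, g3⟩ := hd i
    exact ⟨f + g, f1.add g1, (Lp.coeFn_add (val (Ψ i)) (val (Φ i))).trans (f2.add g2), by simp [f3, g3]⟩
  smul_mem' := by
    rintro a Ψ ⟨c, hc⟩
    refine ⟨a • c, fun i => ?_⟩
    obtain ⟨f, f1, f2, f3⟩ := hc i
    exact ⟨a • f, f1.const_smul a, (Lp.coeFn_smul a (val (Ψ i))).trans (f2.const_smul a),
      by simp [f3]⟩

variable {N : ℕ}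

/-- The component on the `i`-th edge, as an element of `H¹(ℝ⁺)`. -/
def edge (Ψ : EnergySpace N) (i : Fin N) : H1Half := (Ψ : H1Graph N) i

/-- `‖Ψ‖²`, the square of the norm of `L²(𝒢)`. -/
def normSq (Ψ : EnergySpace N) : ℝ := ∑ i, ‖val (edge Ψ i)‖ ^ 2

/-- `‖Ψ'‖²`. -/
def normSqDeriv (Ψ : EnergySpace N) : ℝ := ∑ i, ‖der (edge Ψ i)‖ ^ 2

/-- `‖Ψ‖_{2μ+2}^{2μ+2}`. -/
def normPow (μ : ℝ) (Ψ : EnergySpace N) : ℝ :=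
  ∑ i, ∫ x in Ioi (0 : ℝ), ‖val (edge Ψ i) x‖ ^ (2 * μ + 2)

/-- The Kirchhoff energy `E⁰`. -/
def energy (μ : ℝ) (Ψ : EnergySpace N) : ℝ :=
  1 / 2 * normSqDeriv Ψ - 1 / (2 * μ + 2) * normPow μ Ψ

/-- The mass `M`. -/
def mass (Ψ : EnergySpace N) : ℝ := 1 / 2 * normSq Ψ

/-- The Kirchhoff action `S⁰_ω = E⁰ + ω M`. -/
def action (μ ω : ℝ) (Ψ : EnergySpace N) : ℝ := energy μ Ψ + ω * mass Ψ

/-- The Nehari functional `I⁰_ω`. -/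
def nehariFunctional (μ ω : ℝ) (Ψ : EnergySpace N) : ℝ :=
  normSqDeriv Ψ - normPow μ Ψ + ω * normSq Ψ

/-- The Nehari manifold on the graph with `N` edges. -/
def nehari (N : ℕ) (μ ω : ℝ) : Set (EnergySpace N) :=
  {Ψ | Ψ ≠ 0 ∧ nehariFunctional μ ω Ψ = 0}

/-- The factor that multiplies a nonzero `Ψ` onto the Nehari manifold. -/
def nehariScale (μ ω : ℝ) (Ψ : EnergySpace N) : ℝ :=
  ((normSqDeriv Ψ + ω * normSq Ψ) / normPow μ Ψ) ^ (1 / (2 * μ))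

/-- `d⁰(ω) = (μ+1)^{1/μ} ω^{1/μ+1/2} ∫₀¹ (1 - t²)^{1/μ} dt`. -/
def d0 (μ ω : ℝ) : ℝ :=
  (μ + 1) ^ (1 / μ) * ω ^ (1 / μ + 1 / 2) * ∫ t in (0 : ℝ)..1, (1 - t ^ 2) ^ (1 / μ)

/-- The soliton profile on the line,
`φ_s(x) = [(μ+1)ω]^{1/(2μ)} sech^{1/μ}(μ √ω x)`. -/
def soliton (μ ω x : ℝ) : ℝ :=
  ((μ + 1) * ω) ^ (1 / (2 * μ)) * (1 / Real.cosh (μ * √ω * x)) ^ (1 / μ)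

/-- The action on the line of a differentiable real function `f`. -/
def lineAction (μ ω : ℝ) (f : ℝ → ℝ) : ℝ :=
  1 / 2 * (∫ x, deriv f x ^ 2) + ω / 2 * (∫ x, f x ^ 2)
    - 1 / (2 * μ + 2) * ∫ x, |f x| ^ (2 * μ + 2)

/-- A smooth cutoff on `ℝ⁺` with values in `[0, 1]`, equal to `0` on `[0, 1]` and to `1` on
`[2, ∞)`. Its values on the negative half-line play no role. -/
def IsCutoff (χ : ℝ → ℝ) : Prop :=
  ContDiffOn ℝ (⊤ : ℕ∞) χ (Ici 0) ∧ (∀ x, 0 ≤ x → 0 ≤ χ x ∧ χ x ≤ 1) ∧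
    (∀ x, 0 ≤ x → x ≤ 1 → χ x = 0) ∧ ∀ x, 2 ≤ x → χ x = 1

/-- On the edge `j` the function `Ψ` is the soliton centred at `n`, cut off near the vertex by `χ`;
on all other edges it vanishes. -/
def IsCutoffSoliton (μ ω : ℝ) (χ : ℝ → ℝ) (j : Fin N) (n : ℕ) (Ψ : EnergySpace N) : Prop :=
  ∀ i, val (edge Ψ i) =ᵐ[volume.restrict (Ioi (0 : ℝ))]
    fun x => if i = j then ((soliton μ ω (x - n) * χ x : ℝ) : ℂ) else 0

end

end StarGraph

/-! Lower bound. Let g be `profileSpeed` and G its primitive vanishing at 0. While |ψ| ≤ `peak`, the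
potential part of the action density is g(|ψ|)²/2, so Young's inequality bounds the action below by
∫ g(|ψ|)|ψ'|, and this dominates the variation of G(|ψ|) along every path. Since N ≥ 2, two disjoint
paths lead from any point of the star to infinity, where ψ vanishes. Hence the action is at least 2
G(|ψ(x)|) for every x (`two_mul_primitive_profileSpeed_le`). On its ray, an element of the Nehari
manifold maximizes the action (`sq_sub_rpow_le`), so it can be rescaled until sup |ψ| equals `peak`
without raising the action; this gives `two_mul_primitive_le_action`. No rearrangement or
compactness is needed.

Value of the bound. The soliton solves φ' = -g(φ) for x ≥ 0 (`profileSpeed_soliton`), which is the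
equality case of Young's inequality, so 2 G(`peak`) is ∫ φ'² over the line. One integration by parts
and the substitution t = tanh express all norms of the soliton through this integral and identify it
with `d0`.

Sharpness. Seen from the centre of the escaping soliton, the cutoff recedes to -∞, and dominated
convergence gives the norms of the line soliton in the limit. That soliton satisfies the Nehari
identity on the line, so the scale tends to 1 and the action to `d0`. For weak convergence, a
bounded functional on one edge is a pairing with two L² functions (`exists_inner_representation`),
and these pairings vanish as the profile escapes.

Since H¹ is defined by weak derivatives, the path argument first needs absolutely continuous
representatives; the du Bois-Reymond lemma provides them. -/

namespace StarGraph

/-! ### Absolutely continuous representatives of H¹ functions -/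

/-- Integration by parts of a test function on `(0, ∞)` against a primitive. -/
theorem integral_deriv_smul_primitive {φ : ℝ → ℝ} (hφ : ContDiff ℝ (⊤ : ℕ∞) φ)
    (hc : HasCompactSupport φ) {v : ℝ → ℂ} (hv : ∀ R, IntegrableOn v (Ioc 0 R)) :
    ∫ x in Ioi (0 : ℝ), deriv φ x • (∫ t in (0 : ℝ)..x, v t)
      = -∫ x in Ioi (0 : ℝ), φ x • v x := by
  obtain ⟨R₀, hR₀⟩ := hc.isCompact.bddAbove
  set R := max (R₀ + 1) 1 with hR
  have hR1 : (1 : ℝ) ≤ R := le_max_right _ _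
  have hRz : ∀ x, R ≤ x → x ∉ tsupport φ := fun x hx hx' => by
    have := hR₀ hx'
    linarith [le_max_left (R₀ + 1) 1]
  have hd : Continuous (deriv φ) := hφ.continuous_deriv (by simp)
  have z1 : ∀ x, x ∉ tsupport φ → φ x = 0 := fun x hx => image_eq_zero_of_notMem_tsupport hx
  have z2 : ∀ x, x ∉ tsupport φ → deriv φ x = 0 := fun x hx =>
    image_eq_zero_of_notMem_tsupport (fun h => hx (tsupport_deriv_subset h))
  have hsub : Ioc 0 R ⊆ Ioi (0 : ℝ) := fun x hx => hx.1
  have hR2 : ∀ x ∈ Ioi (0 : ℝ) \ Ioc 0 R, x ∉ tsupport φ := fun x hx =>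
    hRz x (not_lt.1 fun h => hx.2 ⟨hx.1, h.le⟩)
  rw [setIntegral_eq_of_subset_of_forall_sdiff_eq_zero measurableSet_Ioi hsub
    (fun x hx => by rw [z2 x (hR2 x hx), zero_smul]),
    setIntegral_eq_of_subset_of_forall_sdiff_eq_zero measurableSet_Ioi hsub
    (fun x hx => by rw [z1 x (hR2 x hx), zero_smul])]
  have hd_int : Integrable (deriv φ) (volume.restrict (Ioc 0 R)) :=
    hd.integrableOn_Ioc
  -- Fubini on the triangle 0 < t ≤ x ≤ R, encoded by the indicator of `Iic x`. The inner integral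
  -- in x then leaves only -φ(t), because R lies strictly beyond the support of φ.
  have hint : Integrable (Function.uncurry fun x t => deriv φ x • (Iic x).indicator v t)
      ((volume.restrict (Ioc 0 R)).prod (volume.restrict (Ioc 0 R))) := by
    have h := (hd_int.smul_prod (hv R)).indicator
      (measurableSet_le measurable_snd measurable_fst : MeasurableSet {z : ℝ × ℝ | z.2 ≤ z.1})
    refine h.congr (ae_of_all _ fun z => ?_)
    by_cases hz : z.2 ≤ z.1 <;> simp [Function.uncurry, Set.indicator, hz]
  calc ∫ x in Ioc 0 R, deriv φ x • (∫ t in (0 : ℝ)..x, v t)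
      = ∫ x in Ioc 0 R, ∫ t in Ioc 0 R, deriv φ x • (Iic x).indicator v t := by
        refine setIntegral_congr_fun measurableSet_Ioc fun x hx => ?_
        rw [integral_smul, setIntegral_indicator measurableSet_Iic,
          intervalIntegral.integral_of_le hx.1.le, Ioc_inter_Iic, min_eq_right hx.2]
    _ = ∫ t in Ioc 0 R, ∫ x in Ioc 0 R, deriv φ x • (Iic x).indicator v t :=
        integral_integral_swap hint
    _ = ∫ t in Ioc 0 R, -(φ t • v t) := by
        refine setIntegral_congr_fun measurableSet_Ioc fun t ht => ?_
        have e : ∀ x, deriv φ x • (Iic x).indicator v t = (Ici t).indicator (deriv φ) x • v t := by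
          intro x
          by_cases hz : t ≤ x <;> simp [Set.indicator, hz]
        have e2 : Ioc 0 R ∩ Ici t = Icc t R := by
          ext x
          simp only [mem_inter_iff, mem_Ioc, mem_Ici, mem_Icc]
          constructor
          · rintro ⟨⟨_, h⟩, h'⟩; exact ⟨h', h⟩
          · rintro ⟨h', h⟩; exact ⟨⟨lt_of_lt_of_le ht.1 h', h⟩, h'⟩
        simp_rw [e]
        rw [integral_smul_const, setIntegral_indicator measurableSet_Ici, e2,
          integral_Icc_eq_integral_Ioc, ← intervalIntegral.integral_of_le ht.2,
          intervalIntegral.integral_deriv_eq_sub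
            (fun x _ => (hφ.differentiable (by simp)) x) (hd.intervalIntegrable _ _),
          z1 R (hRz R le_rfl), zero_sub, neg_smul]
    _ = _ := integral_neg _

/-- A test function on `(0, ∞)` with vanishing integral is the derivative of a test function. -/
theorem exists_test_primitive {ψ : ℝ → ℝ} (hψ : ContDiff ℝ (⊤ : ℕ∞) ψ)
    (hc : HasCompactSupport ψ) (hs : tsupport ψ ⊆ Ioi 0) (h0 : ∫ x, ψ x = 0) :
    ∃ ζ : ℝ → ℝ, ContDiff ℝ (⊤ : ℕ∞) ζ ∧ HasCompactSupport ζ ∧ tsupport ζ ⊆ Ioi 0 ∧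
      deriv ζ = ψ := by
  obtain ⟨R, hR⟩ := hc.isCompact.bddAbove
  obtain ⟨a, ha, has⟩ : ∃ a, 0 < a ∧ ∀ x ∈ tsupport ψ, a ≤ x := by
    rcases (tsupport ψ).eq_empty_or_nonempty with he | hne
    · exact ⟨1, one_pos, by simp [he]⟩
    · obtain ⟨a, ha, hl⟩ := hc.isCompact.exists_isLeast hne
      exact ⟨a, hs ha, fun x hx => hl hx⟩
  have z : ∀ x, x ∉ tsupport ψ → ψ x = 0 := fun x hx => image_eq_zero_of_notMem_tsupport hx
  set ζ : ℝ → ℝ := fun x => ∫ t in (0 : ℝ)..x, ψ t with hζ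
  have hder : deriv ζ = ψ := funext fun x => hψ.continuous.deriv_integral _ _ _
  have hdiff : Differentiable ℝ ζ := fun x =>
    (intervalIntegral.integral_hasDerivAt_right (hψ.continuous.intervalIntegrable _ _)
      (hψ.continuous.stronglyMeasurableAtFilter _ _) hψ.continuous.continuousAt).differentiableAt
  have hout : ∀ x ∉ Icc a R, ζ x = 0 := by
    intro x hx
    rcases lt_or_ge x a with h | h
    · apply intervalIntegral.integral_zero_ae
      refine ae_of_all _ fun t ht => z t fun h' => ?_
      have h1 := has t h'
      have h2 := ht.2
      rcases le_total 0 x with h3 | h3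
      · rw [max_eq_right h3] at h2; linarith
      · rw [max_eq_left h3] at h2; linarith
    -- To the right of the support the primitive is the full integral of ψ, which is where the zero
    -- mean is needed.
    · have hRx : R < x := not_le.1 fun h' => hx ⟨h, h'⟩
      have hx0 : 0 ≤ x := ha.le.trans h
      simp only [hζ]
      rw [intervalIntegral.integral_of_le hx0, setIntegral_eq_integral_of_forall_compl_eq_zero, h0]
      intro t ht
      refine z t fun h' => ht ⟨ha.trans_le (has t h'), (hR h').trans hRx.le⟩
  have hts : tsupport ζ ⊆ Icc a R := by
    refine closure_minimal (fun x hx => ?_) isClosed_Icc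
    by_contra h
    exact hx (hout x h)
  refine ⟨ζ, ?_, HasCompactSupport.intro isCompact_Icc hout, fun x hx => ha.trans_le (hts hx).1,
    hder⟩
  rw [contDiff_infty_iff_deriv, hder]
  exact ⟨hdiff, hψ⟩

/-- The lemma of du Bois-Reymond on the half-line. -/
theorem ae_eq_const_of_integral_deriv_smul_eq_zero {w : ℝ → ℂ} (hw : LocallyIntegrableOn w (Ioi 0))
    (h : ∀ φ : ℝ → ℝ, ContDiff ℝ (⊤ : ℕ∞) φ → HasCompactSupport φ → tsupport φ ⊆ Ioi 0 →
      ∫ x in Ioi (0 : ℝ), deriv φ x • w x = 0) :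
    ∃ c : ℂ, ∀ᵐ x ∂volume.restrict (Ioi (0 : ℝ)), w x = c := by
  -- A bump around 1 whose outer radius 1/2 keeps its support inside (0, ∞); normalized, it has
  -- integral 1.
  let b : ContDiffBump (1 : ℝ) := ⟨1 / 4, 1 / 2, by norm_num, by norm_num⟩
  set η : ℝ → ℝ := b.normed volume
  have hη : ContDiff ℝ (⊤ : ℕ∞) η := b.contDiff_normed
  have hη1 : ∫ x, η x = 1 := b.integral_normed
  have hηc : HasCompactSupport η := b.hasCompactSupport_normed
  have hηs : tsupport η ⊆ Ioi 0 := by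
    rw [b.tsupport_normed_eq]
    intro x hx
    rw [Real.closedBall_eq_Icc] at hx
    have h1 : (1 : ℝ) - 1 / 2 ≤ x := hx.1
    show 0 < x
    linarith
  have hint : ∀ φ : ℝ → ℝ, Continuous φ → HasCompactSupport φ → tsupport φ ⊆ Ioi 0 →
      Integrable fun x => φ x • w x := by
    intro φ h1 h2 h3
    have h4 : IntegrableOn w (tsupport φ) := hw.integrableOn_compact_subset h3 h2.isCompact
    have h5 : IntegrableOn (fun x => φ x • w x) (tsupport φ) :=
      h4.continuousOn_smul h1.continuousOn h2.isCompact
    refine (integrableOn_iff_integrable_of_support_subset ?_).1 h5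
    intro x hx
    apply subset_tsupport
    intro h0
    exact hx (by simp [h0])
  set c : ℂ := ∫ x, η x • w x
  refine ⟨c, ?_⟩
  have key : ∀ᵐ x, x ∈ Ioi (0 : ℝ) → w x - c = 0 := by
    refine isOpen_Ioi.ae_eq_zero_of_integral_contDiff_smul_eq_zero
      (hw.sub (continuous_const.continuousOn.locallyIntegrableOn measurableSet_Ioi)) ?_
    intro φ h1 h2 h3
    -- The function φ - mη has zero mean, hence is the derivative of a test function, and `h`
    -- applies to that primitive. The resulting identity says that w minus its η-average annihilates
    -- φ.
    set m : ℝ := ∫ x, φ x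
    have hsub : tsupport (fun x => φ x - m * η x) ⊆ tsupport φ ∪ tsupport η := by
      refine closure_minimal (fun x hx => ?_)
        ((isClosed_tsupport φ).union (isClosed_tsupport η))
      by_contra h'
      simp only [mem_union, not_or] at h'
      apply hx
      simp [image_eq_zero_of_notMem_tsupport h'.1, image_eq_zero_of_notMem_tsupport h'.2]
    have hφi : Integrable φ := h1.continuous.integrable_of_hasCompactSupport h2
    have hηi : Integrable η := hη.continuous.integrable_of_hasCompactSupport hηc
    obtain ⟨ζ, k1, k2, k3, k4⟩ := exists_test_primitive (ψ := fun x => φ x - m * η x)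
      (h1.sub (contDiff_const.mul hη)) ((h2.isCompact.union hηc.isCompact).of_isClosed_subset
        (isClosed_tsupport _) hsub)
      (hsub.trans (union_subset h3 hηs))
      (by rw [integral_sub hφi (hηi.const_mul m), integral_const_mul, hη1, mul_one, sub_self])
    have h5 := h ζ k1 k2 k3
    rw [k4, setIntegral_eq_integral_of_forall_compl_eq_zero] at h5
    · have e : ∀ x, (φ x - m * η x) • w x = φ x • w x - m • (η x • w x) := fun x => by
        rw [sub_smul, mul_smul]
      simp_rw [e] at h5
      have hηm : Integrable fun x => m • (η x • w x) := (hint η hη.continuous hηc hηs).smul m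
      rw [integral_sub (hint φ h1.continuous h2 h3) hηm, integral_smul] at h5
      simp_rw [smul_sub]
      rw [integral_sub (hint φ h1.continuous h2 h3) (hφi.smul_const c), integral_smul_const]
      exact h5
    · intro x hx
      have : (fun x => φ x - m * η x) x = 0 :=
        image_eq_zero_of_notMem_tsupport (f := fun x => φ x - m * η x)
          fun h' => hx (union_subset h3 hηs (hsub h'))
      rw [this, zero_smul]
  rw [ae_restrict_iff' measurableSet_Ioi]
  filter_upwards [key] with x hx h0
  exact sub_eq_zero.1 (hx h0)

theorem integrableOn_Ioc_of_memLp_two {v : ℝ → ℂ}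
    (hv : MemLp v 2 (volume.restrict (Ioi (0 : ℝ)))) (R : ℝ) : IntegrableOn v (Ioc 0 R) := by
  have h : MemLp v 2 (volume.restrict (Ioc 0 R)) :=
    hv.mono_measure (Measure.restrict_mono (fun x hx => hx.1) le_rfl)
  exact h.integrable one_le_two

theorem continuousOn_primitive_Ici {v : ℝ → ℂ} (hv : ∀ R, IntegrableOn v (Ioc 0 R)) :
    ContinuousOn (fun x => ∫ t in (0 : ℝ)..x, v t) (Ici 0) := by
  intro x hx
  have hx0 : (0 : ℝ) ≤ x := hx
  have h : IntegrableOn v (uIcc 0 (x + 1)) := by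
    rw [uIcc_of_le (by linarith), integrableOn_Icc_iff_integrableOn_Ioc]
    exact hv _
  have h2 := intervalIntegral.continuousOn_primitive_interval h x
    (by rw [uIcc_of_le (by linarith)]; exact ⟨hx0, by linarith⟩)
  refine h2.mono_of_mem_nhdsWithin ?_
  rw [uIcc_of_le (by linarith)]
  exact mem_nhdsWithin.2 ⟨Iio (x + 1), isOpen_Iio, by simp, fun y hy => ⟨hy.2, le_of_lt hy.1⟩⟩

/-- Every element of `H¹(ℝ⁺)` has the representative `c + ∫₀ˣ u'`. -/
theorem exists_ae_eq_const_add_primitive (u : H1Half) :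
    ∃ c : ℂ, val u =ᵐ[volume.restrict (Ioi (0 : ℝ))]
      fun x => c + ∫ t in (0 : ℝ)..x, der u t := by
  have hv := integrableOn_Ioc_of_memLp_two (Lp.memLp (der u))
  have hc := continuousOn_primitive_Ici hv
  have hcl : LocallyIntegrableOn (fun x => ∫ t in (0 : ℝ)..x, der u t) (Ioi 0) :=
    (hc.mono Ioi_subset_Ici_self).locallyIntegrableOn measurableSet_Ioi
  have hul : LocallyIntegrableOn (val u) (Ioi 0) := by
    rw [locallyIntegrableOn_iff isOpen_Ioi.isLocallyClosed]
    intro k hk hkc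
    obtain ⟨R, hR⟩ := hkc.bddAbove
    exact (integrableOn_Ioc_of_memLp_two (Lp.memLp (val u)) R).mono_set
      fun x hx => ⟨hk hx, hR hx⟩
  -- The difference of u and the primitive of its weak derivative has zero weak derivative.
  obtain ⟨c, hc'⟩ := ae_eq_const_of_integral_deriv_smul_eq_zero (hul.sub hcl) (by
    intro φ h1 h2 h3
    have hd : Continuous (deriv φ) := h1.continuous_deriv (by simp)
    have e := integral_deriv_smul_primitive h1 h2 hv
    have e' : ∫ x in Ioi (0 : ℝ), deriv φ x • val u x = -∫ x in Ioi (0 : ℝ), φ x • der u x :=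
      u.2 φ h1 h2 h3
    have i1 : Integrable (fun x => deriv φ x • val u x) (volume.restrict (Ioi (0 : ℝ))) :=
      integrable_smul_of_test hd h2.deriv _
    have i2 : Integrable (fun x => deriv φ x • ∫ t in (0 : ℝ)..x, der u t)
        (volume.restrict (Ioi (0 : ℝ))) := by
      have hts : tsupport (deriv φ) ⊆ Ioi 0 := tsupport_deriv_subset.trans h3
      have k1 : IntegrableOn (fun x => deriv φ x • ∫ t in (0 : ℝ)..x, der u t)
          (tsupport (deriv φ)) :=
        (hcl.integrableOn_compact_subset hts h2.deriv.isCompact).continuousOn_smul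
          hd.continuousOn h2.deriv.isCompact
      refine Integrable.restrict ((integrableOn_iff_integrable_of_support_subset ?_).1 k1)
      intro x hx
      apply subset_tsupport
      intro h0
      exact hx (by simp [h0])
    simp only [Pi.sub_apply, smul_sub]
    rw [integral_sub i1 i2, e, e', sub_self])
  refine ⟨c, ?_⟩
  filter_upwards [hc'] with x hx
  rw [← hx]
  simp

/-- The components of an element of the energy space have absolutely continuous representatives
with a common value at the vertex. -/
theorem exists_rep {N : ℕ} (Ψ : EnergySpace N) :
    ∃ c : ℂ, ∀ i, val (edge Ψ i) =ᵐ[volume.restrict (Ioi (0 : ℝ))]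
      fun x => c + ∫ t in (0 : ℝ)..x, der (edge Ψ i) t := by
  obtain ⟨c, hc⟩ := Ψ.2
  refine ⟨c, fun i => ?_⟩
  obtain ⟨f, h1, h2, h3⟩ := hc i
  obtain ⟨d, hd⟩ := exists_ae_eq_const_add_primitive (edge Ψ i)
  have hcont : ContinuousOn (fun x => d + ∫ t in (0 : ℝ)..x, der (edge Ψ i) t) (Ici 0) :=
    continuousOn_const.add
      (continuousOn_primitive_Ici (integrableOn_Ioc_of_memLp_two (Lp.memLp (der (edge Ψ i)))))
  have hae : f =ᵐ[volume.restrict (Ici (0 : ℝ))]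
      fun x => d + ∫ t in (0 : ℝ)..x, der (edge Ψ i) t := by
    rw [← restrict_Ioi_eq_restrict_Ici]
    exact h2.symm.trans hd
  -- Both representatives are continuous up to the vertex, so almost everywhere equality on (0, ∞)
  -- becomes equality at 0 as well and identifies the constant.
  have := Measure.eqOn_of_ae_eq hae h1 hcont (by rw [interior_Ici, closure_Ioi])
    (self_mem_Ici (a := (0 : ℝ)))
  have hcd : c = d := by rw [← h3, this]; simp
  rw [hcd]
  exact hd

/-! ### Variation of a primitive along the modulus -/

theorem continuous_primitive_of_continuous {g : ℝ → ℝ} (hg : Continuous g) (a : ℝ) :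
    Continuous fun s => ∫ r in a..s, g r :=
  intervalIntegral.continuous_primitive (fun _ _ => hg.intervalIntegrable _ _) a

/-- For `f` absolutely continuous with derivative `v`, the variation of `G ∘ ‖f‖` is controlled by
the integral of `G'(‖f‖) ‖v‖`. -/
theorem abs_primitive_norm_le {g : ℝ → ℝ} (hg : Continuous g) (hg0 : ∀ s, 0 ≤ g s) {f v : ℝ → ℂ}
    {a b : ℝ} (hab : a ≤ b) (hv : IntegrableOn v (Ioc a b))
    (hf : ∀ x ∈ Icc a b, f x = f a + ∫ t in a..x, v t) :
    |∫ s in ‖f a‖..‖f b‖, g s| ≤ ∫ t in a..b, g ‖f t‖ * ‖v t‖ := by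
  have hvi : IntegrableOn v (uIcc a b) := by
    rwa [uIcc_of_le hab, integrableOn_Icc_iff_integrableOn_Ioc]
  have hfc : ContinuousOn f (Icc a b) := by
    have := intervalIntegral.continuousOn_primitive_interval hvi
    rw [uIcc_of_le hab] at this
    exact (continuousOn_const.add this).congr hf
  rw [uIcc_of_le hab] at hvi
  have hnv : IntegrableOn (fun t => ‖v t‖) (Icc a b) := hvi.norm
  have hgv : IntegrableOn (fun t => g ‖f t‖ * ‖v t‖) (Icc a b) :=
    hnv.continuousOn_mul (hg.comp_continuousOn hfc.norm) isCompact_Icc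
  have hii : ∀ {h : ℝ → ℝ}, IntegrableOn h (Icc a b) → ∀ {x y}, x ∈ Icc a b → y ∈ Icc a b →
      IntervalIntegrable h volume x y := by
    intro h hh x y hx hy
    rw [intervalIntegrable_iff]
    refine hh.mono_set (uIoc_subset_uIcc.trans ?_)
    exact uIcc_subset_Icc hx hy
  have hvx : ∀ {x y}, x ∈ Icc a b → y ∈ Icc a b → IntervalIntegrable v volume x y := by
    intro x y hx hy
    rw [intervalIntegrable_iff]
    exact hvi.mono_set (uIoc_subset_uIcc.trans (uIcc_subset_Icc hx hy))
  have haI : a ∈ Icc a b := left_mem_Icc.2 hab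
  have hbI : b ∈ Icc a b := right_mem_Icc.2 hab
  -- The modulus of f need not be differentiable, so there is no direct chain rule. With slack ε,
  -- the set of endpoints up to which the estimate holds is closed and extends to the right of each
  -- of its points, so it is all of [a, b].
  have key : ∀ ε > 0, |∫ s in ‖f a‖..‖f b‖, g s| ≤
      (∫ t in a..b, g ‖f t‖ * ‖v t‖) + ε * ∫ t in a..b, ‖v t‖ := by
    intro ε hε
    set H : ℝ → ℝ := fun t => g ‖f t‖ * ‖v t‖ + ε * ‖v t‖ with hH
    have hHi : IntegrableOn H (Icc a b) := hgv.add (hnv.const_mul ε)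
    set s : Set ℝ := {y | |∫ s in ‖f a‖..‖f y‖, g s| ≤ ∫ t in a..y, H t} with hs
    have hcl : IsClosed (s ∩ Icc a b) := by
      have c1 : ContinuousOn (fun y => |∫ s in ‖f a‖..‖f y‖, g s|) (Icc a b) :=
        ((continuous_primitive_of_continuous hg _).comp_continuousOn hfc.norm).abs
      have c2 : ContinuousOn (fun y => ∫ t in a..y, H t) (Icc a b) := by
        have := intervalIntegral.continuousOn_primitive_interval (a := a) (b := b) (f := H)
          (by rwa [uIcc_of_le hab])
        rwa [uIcc_of_le hab] at this
      have := isClosed_Icc.isClosed_le c1 c2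
      convert! this using 1
      ext y
      simp [hs, and_comm]
    have hsub : Icc a b ⊆ s := by
      refine hcl.Icc_subset_of_forall_mem_nhdsWithin (by simp [hs]) ?_
      rintro x ⟨hxs, hx⟩
      have hxI : x ∈ Icc a b := ⟨hx.1, hx.2.le⟩
      -- Half of ε pays for replacing g(r) by g(‖f x‖) on the left side (`hd2`), the other half for
      -- replacing g(‖f x‖) by g(‖f t‖) under the integral (`hd3`).
      obtain ⟨δ, hδ, hgδ⟩ := Metric.continuousAt_iff.1 (hg.continuousAt (x := ‖f x‖)) (ε / 2)
        (by positivity)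
      have hnear : ∀ᶠ y in 𝓝[>] x, y ≤ b ∧ dist ‖f y‖ ‖f x‖ < δ := by
        have h1 : ∀ᶠ y in 𝓝[>] x, y ∈ Ioo x b := Ioo_mem_nhdsGT hx.2
        have h2 : ∀ᶠ y in 𝓝[Icc a b] x, dist ‖f y‖ ‖f x‖ < δ :=
          (hfc.norm x hxI).eventually (Metric.ball_mem_nhds _ hδ)
        have h3 : 𝓝[>] x ≤ 𝓝[Icc a b] x := by
          refine nhdsWithin_le_of_mem ?_
          filter_upwards [h1] with y hy using ⟨hx.1.trans hy.1.le, hy.2.le⟩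
        filter_upwards [h1, h3 h2] with y hy hy2 using ⟨hy.2.le, hy2⟩
      obtain ⟨u, hu, hus⟩ := (mem_nhdsGT_iff_exists_Ioo_subset).1 hnear
      refine mem_of_superset (Ioo_mem_nhdsGT hu) fun y hy => ?_
      have hyb := (hus hy).1
      have hyd := (hus hy).2
      have hxy : x ≤ y := hy.1.le
      have hyI : y ∈ Icc a b := ⟨hx.1.trans hxy, hyb⟩
      have hfxy : f y - f x = ∫ t in x..y, v t := by
        rw [hf y hyI, hf x hxI, add_sub_add_left_eq_sub,
          intervalIntegral.integral_interval_sub_left (hvx haI hyI) (hvx haI hxI)]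
      have hd1 : |‖f y‖ - ‖f x‖| ≤ ∫ t in x..y, ‖v t‖ := by
        refine (abs_norm_sub_norm_le _ _).trans ?_
        rw [hfxy]
        exact intervalIntegral.norm_integral_le_integral_norm hxy
      have hd2 : |∫ s in ‖f x‖..‖f y‖, g s| ≤ (g ‖f x‖ + ε / 2) * |‖f y‖ - ‖f x‖| := by
        rw [← Real.norm_eq_abs]
        refine intervalIntegral.norm_integral_le_of_norm_le_const fun r hr => ?_
        have hr' : dist r ‖f x‖ < δ := by
          refine lt_of_le_of_lt ?_ hyd
          rw [Real.dist_eq, Real.dist_eq]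
          exact abs_sub_left_of_mem_uIcc (uIoc_subset_uIcc hr)
        have := hgδ hr'
        rw [Real.dist_eq] at this
        rw [Real.norm_of_nonneg (hg0 r)]
        linarith [(abs_lt.1 this).2]
      have hd3 : (g ‖f x‖ + ε / 2) * ∫ t in x..y, ‖v t‖ ≤ ∫ t in x..y, H t := by
        rw [← intervalIntegral.integral_const_mul]
        refine intervalIntegral.integral_mono_on_of_le_Ioo hxy ((hii hnv hxI hyI).const_mul _)
          (hii hHi hxI hyI) fun t ht => ?_
        have ht' := hgδ (hus ⟨ht.1, ht.2.trans hy.2⟩).2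
        rw [Real.dist_eq] at ht'
        have h4 := (abs_lt.1 ht').1
        have h5 : g ‖f x‖ + ε / 2 ≤ g ‖f t‖ + ε := by linarith
        calc (g ‖f x‖ + ε / 2) * ‖v t‖ ≤ (g ‖f t‖ + ε) * ‖v t‖ := by gcongr
          _ = H t := by simp only [hH]; ring
      have hpos : 0 ≤ g ‖f x‖ + ε / 2 := by have := hg0 ‖f x‖; positivity
      have hxs' : |∫ s in ‖f a‖..‖f x‖, g s| ≤ ∫ t in a..x, H t := hxs
      show |∫ s in ‖f a‖..‖f y‖, g s| ≤ ∫ t in a..y, H t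
      rw [← intervalIntegral.integral_add_adjacent_intervals (hg.intervalIntegrable _ ‖f x‖)
        (hg.intervalIntegrable _ _),
        ← intervalIntegral.integral_add_adjacent_intervals (hii hHi haI hxI) (hii hHi hxI hyI)]
      calc _ ≤ |∫ s in ‖f a‖..‖f x‖, g s| + |∫ s in ‖f x‖..‖f y‖, g s| := abs_add_le _ _
        _ ≤ _ := add_le_add hxs' (hd2.trans ((mul_le_mul_of_nonneg_left hd1 hpos).trans hd3))
    have h := hsub hbI
    have h' : |∫ s in ‖f a‖..‖f b‖, g s| ≤ ∫ t in a..b, H t := h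
    rwa [hH, intervalIntegral.integral_add (hii hgv haI hbI)
      ((hii hnv haI hbI).const_mul ε), intervalIntegral.integral_const_mul] at h'
  have hlim : Tendsto (fun ε => (∫ t in a..b, g ‖f t‖ * ‖v t‖) + ε * ∫ t in a..b, ‖v t‖)
      (𝓝[>] (0 : ℝ)) (𝓝 (∫ t in a..b, g ‖f t‖ * ‖v t‖)) := by
    have : Continuous fun ε : ℝ => (∫ t in a..b, g ‖f t‖ * ‖v t‖) + ε * ∫ t in a..b, ‖v t‖ := by
      fun_prop
    simpa using (this.tendsto 0).mono_left nhdsWithin_le_nhds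
  exact ge_of_tendsto hlim (eventually_mem_nhdsWithin.mono key)

section HalfLine

variable {f v : ℝ → ℂ}

theorem eq_add_primitive_of_le (hv : MemLp v 2 (volume.restrict (Ioi (0 : ℝ))))
    (hf : ∀ x, 0 ≤ x → f x = f 0 + ∫ t in (0 : ℝ)..x, v t) {x y : ℝ} (hx : 0 ≤ x) (hy : 0 ≤ y) :
    f y = f x + ∫ t in x..y, v t := by
  have hi : ∀ z, 0 ≤ z → IntervalIntegrable v volume 0 z := fun z hz =>
    (intervalIntegrable_iff_integrableOn_Ioc_of_le hz).2 (integrableOn_Ioc_of_memLp_two hv z)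
  rw [hf y hy, hf x hx, ← intervalIntegral.integral_interval_sub_left (hi y hy) (hi x hx)]
  ring

theorem abs_primitive_norm_le_setIntegral {g : ℝ → ℝ} (hg : Continuous g) (hg0 : ∀ s, 0 ≤ g s)
    (hv : MemLp v 2 (volume.restrict (Ioi (0 : ℝ))))
    (hf : ∀ x, 0 ≤ x → f x = f 0 + ∫ t in (0 : ℝ)..x, v t) {x y : ℝ} (hx : 0 ≤ x) (hxy : x ≤ y) :
    |∫ s in ‖f x‖..‖f y‖, g s| ≤ ∫ t in Ioc x y, g ‖f t‖ * ‖v t‖ := by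
  rw [← intervalIntegral.integral_of_le hxy]
  exact abs_primitive_norm_le hg hg0 hxy
    ((integrableOn_Ioc_of_memLp_two hv y).mono_set (Ioc_subset_Ioc_left hx))
    fun z hz => eq_add_primitive_of_le hv hf hx (hx.trans hz.1)

/-- A function in `H¹(ℝ⁺)` is bounded. -/
theorem exists_norm_le (hv : MemLp v 2 (volume.restrict (Ioi (0 : ℝ))))
    (hfm : MemLp f 2 (volume.restrict (Ioi (0 : ℝ))))
    (hf : ∀ x, 0 ≤ x → f x = f 0 + ∫ t in (0 : ℝ)..x, v t) : ∃ C, ∀ x, 0 ≤ x → ‖f x‖ ≤ C := by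
  -- The choice g(s) = 2|s| makes G(s) = s² for s ≥ 0 and bounds ‖f(x)‖² by ‖f(0)‖² + 2∫‖f‖‖v‖. The
  -- absolute value only serves to keep g nonnegative on all of ℝ.
  have hint : IntegrableOn (fun t => 2 * |‖f t‖| * ‖v t‖) (Ioi 0) := by
    have h : Integrable (fun t => ‖f t‖ * ‖v t‖) (volume.restrict (Ioi (0 : ℝ))) :=
      hfm.norm.integrable_mul hv.norm
    refine (h.const_mul 2).congr (ae_of_all _ fun t => ?_)
    simp only [abs_norm]
    ring
  set J := ∫ t in Ioi (0 : ℝ), 2 * |‖f t‖| * ‖v t‖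
  refine ⟨√(‖f 0‖ ^ 2 + J), fun x hx => ?_⟩
  have h1 := abs_primitive_norm_le_setIntegral (g := fun s => 2 * |s|) (by fun_prop)
    (fun s => by positivity) hv hf le_rfl hx
  have h2 : ∫ t in Ioc 0 x, 2 * |‖f t‖| * ‖v t‖ ≤ J :=
    setIntegral_mono_set hint (ae_of_all _ fun t => by positivity)
      (Ioc_subset_Ioi_self.eventuallyLE)
  have h3 : ∫ s in ‖f 0‖..‖f x‖, 2 * |s| = ‖f x‖ ^ 2 - ‖f 0‖ ^ 2 := by
    have : ∫ s in ‖f 0‖..‖f x‖, 2 * |s| = ∫ s in ‖f 0‖..‖f x‖, 2 * s := by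
      refine intervalIntegral.integral_congr fun s hs => ?_
      have : 0 ≤ s := (le_min (norm_nonneg _) (norm_nonneg _)).trans hs.1
      simp [abs_of_nonneg this]
    rw [this, intervalIntegral.integral_const_mul, integral_id]
    ring
  rw [h3] at h1
  apply Real.le_sqrt_of_sq_le
  linarith [le_abs_self (‖f x‖ ^ 2 - ‖f 0‖ ^ 2)]

/-- The linear bound on g places g(‖f‖) in L², and a product of two L² functions is integrable. -/
theorem integrableOn_comp_norm_mul_norm {g : ℝ → ℝ} (hg : Continuous g) (hg0 : ∀ s, 0 ≤ g s) {C : ℝ}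
    (hgC : ∀ s, 0 ≤ s → g s ≤ C * s)
    (hv : MemLp v 2 (volume.restrict (Ioi (0 : ℝ))))
    (hfm : MemLp f 2 (volume.restrict (Ioi (0 : ℝ)))) :
    IntegrableOn (fun t => g ‖f t‖ * ‖v t‖) (Ioi 0) := by
  have hgf : MemLp (fun t => g ‖f t‖) 2 (volume.restrict (Ioi (0 : ℝ))) := by
    refine hfm.of_le_mul (c := C) (hg.comp_aestronglyMeasurable hfm.1.norm) (ae_of_all _ fun t => ?_)
    rw [Real.norm_of_nonneg (hg0 _)]
    exact hgC _ (norm_nonneg _)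
  exact hgf.integrable_mul hv.norm

/-- The variation of `G ∘ ‖f‖` between a point and infinity, where `f` vanishes. -/
theorem primitive_norm_le_setIntegral_Ioi {g : ℝ → ℝ} (hg : Continuous g) (hg0 : ∀ s, 0 ≤ g s)
    {C : ℝ} (hgC : ∀ s, 0 ≤ s → g s ≤ C * s)
    (hv : MemLp v 2 (volume.restrict (Ioi (0 : ℝ))))
    (hfm : MemLp f 2 (volume.restrict (Ioi (0 : ℝ))))
    (hf : ∀ x, 0 ≤ x → f x = f 0 + ∫ t in (0 : ℝ)..x, v t) {x : ℝ} (hx : 0 ≤ x) :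
    ∫ s in (0 : ℝ)..‖f x‖, g s ≤ ∫ t in Ioi x, g ‖f t‖ * ‖v t‖ := by
  have hint : IntegrableOn (fun t => g ‖f t‖ * ‖v t‖) (Ioi x) :=
    (integrableOn_comp_norm_mul_norm hg hg0 hgC hv hfm).mono_set (Ioi_subset_Ioi hx)
  set J := ∫ t in Ioi x, g ‖f t‖ * ‖v t‖
  by_contra! hlt
  -- If the claim failed, G(‖f‖) would stay above δ > 0 on all of (x, ∞). But G(‖f‖) ≤ C‖f‖² is
  -- integrable there, and a positive constant is not. Thus decay at infinity is never needed
  -- pointwise.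
  set δ := (∫ s in (0 : ℝ)..‖f x‖, g s) - J with hδ
  have hδ0 : 0 < δ := sub_pos.2 hlt
  have hlow : ∀ y, x ≤ y → δ ≤ ∫ s in (0 : ℝ)..‖f y‖, g s := by
    intro y hy
    have h1 := abs_primitive_norm_le_setIntegral hg hg0 hv hf hx hy
    have h2 : ∫ t in Ioc x y, g ‖f t‖ * ‖v t‖ ≤ J :=
      setIntegral_mono_set hint (ae_of_all _ fun t => mul_nonneg (hg0 _) (norm_nonneg _))
        (Ioc_subset_Ioi_self.eventuallyLE)
    have h3 := intervalIntegral.integral_add_adjacent_intervals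
      (hg.intervalIntegrable (μ := volume) 0 ‖f x‖) (hg.intervalIntegrable ‖f x‖ ‖f y‖)
    have h4 := neg_abs_le (∫ s in ‖f x‖..‖f y‖, g s)
    linarith
  have hup : ∀ y, ∫ s in (0 : ℝ)..‖f y‖, g s ≤ C * ‖f y‖ ^ 2 := by
    intro y
    have h := intervalIntegral.norm_integral_le_of_norm_le_const (f := g) (a := 0) (b := ‖f y‖)
      (C := C * ‖f y‖) (fun s hs => by
        rw [uIoc_of_le (norm_nonneg _)] at hs
        rw [Real.norm_of_nonneg (hg0 _)]
        refine (hgC s hs.1.le).trans (mul_le_mul_of_nonneg_left hs.2 ?_)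
        have := (hg0 1).trans (hgC 1 zero_le_one)
        linarith)
    rw [sub_zero, abs_norm] at h
    calc _ ≤ _ := le_abs_self _
      _ ≤ _ := h
      _ = _ := by ring
  have hsq : IntegrableOn (fun y => C * ‖f y‖ ^ 2) (Ioi x) := by
    have : IntegrableOn (fun y => ‖f y‖ ^ 2) (Ioi 0) := hfm.norm.integrable_sq
    exact (this.mono_set (Ioi_subset_Ioi hx)).const_mul C
  have hconst : IntegrableOn (fun _ : ℝ => δ) (Ioi x) := by
    refine Integrable.mono' hsq aestronglyMeasurable_const ?_
    refine (ae_restrict_iff' measurableSet_Ioi).2 (ae_of_all _ fun y hy => ?_)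
    rw [Real.norm_of_nonneg hδ0.le]
    exact (hlow y (le_of_lt hy)).trans (hup y)
  rw [integrableOn_const_iff] at hconst
  simp [hδ0.ne'] at hconst

end HalfLine

/-! ### The profile speed and the peak height -/

theorem sq_norm_eq_integral (u : L2Half) : ‖u‖ ^ 2 = ∫ x in Ioi (0 : ℝ), ‖u x‖ ^ 2 := by
  have h : ((‖u‖ ^ 2 : ℝ) : ℂ) = ((∫ x in Ioi (0 : ℝ), ‖u x‖ ^ 2 : ℝ) : ℂ) := by
    have h1 := inner_self_eq_norm_sq_to_K (𝕜 := ℂ) u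
    rw [L2.inner_def] at h1
    simp_rw [inner_self_eq_norm_sq_to_K] at h1
    rw [← integral_complex_ofReal]
    push_cast
    exact h1.symm
  exact_mod_cast h

/-- The square root of `ω s² - |s|^{2μ+2} / (μ+1)`: the speed of the soliton profile at height
`s`. -/
noncomputable def profileSpeed (μ ω s : ℝ) : ℝ := √(ω * s ^ 2 - |s| ^ (2 * μ + 2) / (μ + 1))

/-- The maximum of the soliton. -/
noncomputable def peak (μ ω : ℝ) : ℝ := ((μ + 1) * ω) ^ (1 / (2 * μ))

theorem continuous_profileSpeed {μ : ℝ} (hμ : 0 < μ) (ω : ℝ) : Continuous (profileSpeed μ ω) := by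
  have h : Continuous fun s : ℝ => |s| ^ (2 * μ + 2) :=
    continuous_abs.rpow_const fun _ => Or.inr (by positivity)
  unfold profileSpeed
  fun_prop

theorem profileSpeed_nonneg (μ ω s : ℝ) : 0 ≤ profileSpeed μ ω s := Real.sqrt_nonneg _

theorem profileSpeed_le {μ ω : ℝ} (hμ : 0 < μ) {s : ℝ} (hs : 0 ≤ s) :
    profileSpeed μ ω s ≤ √ω * s := by
  have h : √ω * s = √(ω * s ^ 2) := by
    rw [Real.sqrt_mul' _ (sq_nonneg s), Real.sqrt_sq hs]
  rw [h]
  apply Real.sqrt_le_sqrt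
  have : 0 ≤ |s| ^ (2 * μ + 2) / (μ + 1) := by positivity
  linarith

theorem peak_pos {μ ω : ℝ} (hμ : 0 < μ) (hω : 0 < ω) : 0 < peak μ ω := by
  unfold peak
  positivity

theorem peak_rpow {μ ω : ℝ} (hμ : 0 < μ) (hω : 0 < ω) : peak μ ω ^ (2 * μ) = (μ + 1) * ω := by
  unfold peak
  rw [← Real.rpow_mul (by positivity), one_div_mul_cancel (by positivity), Real.rpow_one]

/-- Up to the peak, s^(2μ) ≤ (μ+1)ω makes the radicand nonnegative. Above it the real square root is
truncated to 0 and the identity fails, which is why the path argument requires an amplitude of at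
most `peak`. -/
theorem profileSpeed_sq {μ ω s : ℝ} (hμ : 0 < μ) (hω : 0 < ω) (hs : 0 ≤ s) (hsp : s ≤ peak μ ω) :
    profileSpeed μ ω s ^ 2 = ω * s ^ 2 - s ^ (2 * μ + 2) / (μ + 1) := by
  unfold profileSpeed
  rw [abs_of_nonneg hs]
  apply Real.sq_sqrt
  have h1 : s ^ (2 * μ) ≤ (μ + 1) * ω := by
    rw [← peak_rpow hμ hω]
    exact Real.rpow_le_rpow hs hsp (by positivity)
  have h2 : s ^ (2 * μ + 2) = s ^ (2 * μ) * s ^ 2 := by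
    rw [Real.rpow_add_of_nonneg hs (by positivity) (by norm_num)]
    norm_num
  rw [h2, sub_nonneg, div_le_iff₀ (by positivity)]
  nlinarith [mul_le_mul_of_nonneg_right h1 (sq_nonneg s)]

theorem integrableOn_norm_rpow {μ : ℝ} (hμ : 0 < μ) {f : ℝ → ℂ} {C : ℝ}
    (hfm : MemLp f 2 (volume.restrict (Ioi (0 : ℝ)))) (hfC : ∀ x, 0 ≤ x → ‖f x‖ ≤ C) :
    IntegrableOn (fun x => ‖f x‖ ^ (2 * μ + 2)) (Ioi 0) := by
  have h1 : IntegrableOn (fun x => C ^ (2 * μ) * ‖f x‖ ^ 2) (Ioi 0) :=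
    hfm.norm.integrable_sq.const_mul _
  refine Integrable.mono' h1 ?_ ?_
  · exact (Real.continuous_rpow_const (by positivity)).comp_aestronglyMeasurable hfm.1.norm
  · refine (ae_restrict_iff' measurableSet_Ioi).2 (ae_of_all _ fun x hx => ?_)
    rw [Real.norm_of_nonneg (by positivity),
      Real.rpow_add_of_nonneg (norm_nonneg _) (by positivity) (by norm_num)]
    have := Real.rpow_le_rpow (norm_nonneg _) (hfC x (le_of_lt hx)) (by positivity : 0 ≤ 2 * μ)
    norm_num
    gcongr

/-! ### Two paths to infinity and the lower bound on the Nehari manifold -/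

section Family

variable {N : ℕ} {f v : Fin N → ℝ → ℂ}

/-- From any point of the star graph there are two disjoint paths to infinity. -/
theorem two_mul_primitive_le_sum (hN : 2 ≤ N) {g : ℝ → ℝ} (hg : Continuous g) (hg0 : ∀ s, 0 ≤ g s)
    {C : ℝ} (hgC : ∀ s, 0 ≤ s → g s ≤ C * s)
    (hv : ∀ i, MemLp (v i) 2 (volume.restrict (Ioi (0 : ℝ))))
    (hfm : ∀ i, MemLp (f i) 2 (volume.restrict (Ioi (0 : ℝ))))
    (hf : ∀ i x, 0 ≤ x → f i x = f i 0 + ∫ t in (0 : ℝ)..x, v i t)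
    (hf0 : ∀ i j, f i 0 = f j 0) (i : Fin N) {x : ℝ} (hx : 0 ≤ x) :
    2 * ∫ s in (0 : ℝ)..‖f i x‖, g s ≤ ∑ k, ∫ t in Ioi (0 : ℝ), g ‖f k t‖ * ‖v k t‖ := by
  have : Nontrivial (Fin N) := Fin.nontrivial_iff_two_le.2 hN
  -- One path runs outward from x along edge i; the other goes back to the vertex and then out along
  -- edge j.
  obtain ⟨j, hj⟩ := exists_ne i
  have h1 := primitive_norm_le_setIntegral_Ioi hg hg0 hgC (hv i) (hfm i) (hf i) hx
  have h2 := abs_primitive_norm_le_setIntegral hg hg0 (hv i) (hf i) le_rfl hx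
  have h3 := primitive_norm_le_setIntegral_Ioi hg hg0 hgC (hv j) (hfm j) (hf j) le_rfl
  have h4 := intervalIntegral.integral_add_adjacent_intervals
    (hg.intervalIntegrable (μ := volume) 0 ‖f i 0‖) (hg.intervalIntegrable ‖f i 0‖ ‖f i x‖)
  have h5 := le_abs_self (∫ s in ‖f i 0‖..‖f i x‖, g s)
  have hint := integrableOn_comp_norm_mul_norm hg hg0 hgC (hv i) (hfm i)
  have h6 : ∫ t in Ioi (0 : ℝ), g ‖f i t‖ * ‖v i t‖
      = (∫ t in Ioc 0 x, g ‖f i t‖ * ‖v i t‖) + ∫ t in Ioi x, g ‖f i t‖ * ‖v i t‖ := by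
    rw [← setIntegral_union Ioc_disjoint_Ioi_same measurableSet_Ioi
      (hint.mono_set Ioc_subset_Ioi_self) (hint.mono_set (Ioi_subset_Ioi hx)),
      Ioc_union_Ioi_eq_Ioi hx]
  have h7 : ∑ k ∈ {i, j}, ∫ t in Ioi (0 : ℝ), g ‖f k t‖ * ‖v k t‖
      ≤ ∑ k, ∫ t in Ioi (0 : ℝ), g ‖f k t‖ * ‖v k t‖ :=
    Finset.sum_le_sum_of_subset_of_nonneg (Finset.subset_univ _) fun k _ _ =>
      integral_nonneg fun t => mul_nonneg (hg0 _) (norm_nonneg _)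
  rw [Finset.sum_pair hj.symm] at h7
  rw [hf0 i j] at h2 h4 h5
  linarith

/-- The lower bound for the action of a family whose modulus stays below the peak of the
soliton. -/
theorem two_mul_primitive_profileSpeed_le (hN : 2 ≤ N) {μ ω : ℝ} (hμ : 0 < μ) (hω : 0 < ω)
    (hv : ∀ i, MemLp (v i) 2 (volume.restrict (Ioi (0 : ℝ))))
    (hfm : ∀ i, MemLp (f i) 2 (volume.restrict (Ioi (0 : ℝ))))
    (hf : ∀ i x, 0 ≤ x → f i x = f i 0 + ∫ t in (0 : ℝ)..x, v i t)
    (hf0 : ∀ i j, f i 0 = f j 0) (hpeak : ∀ i x, 0 ≤ x → ‖f i x‖ ≤ peak μ ω)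
    (i : Fin N) {x : ℝ} (hx : 0 ≤ x) :
    2 * ∫ s in (0 : ℝ)..‖f i x‖, profileSpeed μ ω s ≤
      1 / 2 * (∑ k, ∫ t in Ioi (0 : ℝ), ‖v k t‖ ^ 2)
        + ω / 2 * (∑ k, ∫ t in Ioi (0 : ℝ), ‖f k t‖ ^ 2)
        - 1 / (2 * μ + 2) * ∑ k, ∫ t in Ioi (0 : ℝ), ‖f k t‖ ^ (2 * μ + 2) := by
  have hg := continuous_profileSpeed hμ ω
  have hg0 := profileSpeed_nonneg μ ω
  have hgC : ∀ s, 0 ≤ s → profileSpeed μ ω s ≤ √ω * s := fun s hs => profileSpeed_le hμ hs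
  refine (two_mul_primitive_le_sum hN hg hg0 hgC hv hfm hf hf0 i hx).trans ?_
  rw [Finset.mul_sum, Finset.mul_sum, Finset.mul_sum, ← Finset.sum_add_distrib,
    ← Finset.sum_sub_distrib]
  refine Finset.sum_le_sum fun k _ => ?_
  have i1 : IntegrableOn (fun t => ‖v k t‖ ^ 2) (Ioi 0) := (hv k).norm.integrable_sq
  have i2 : IntegrableOn (fun t => ‖f k t‖ ^ 2) (Ioi 0) := (hfm k).norm.integrable_sq
  have i3 := integrableOn_norm_rpow hμ (hfm k) (hpeak k)
  have i4 : IntegrableOn (fun t => 1 / 2 * ‖v k t‖ ^ 2 + ω / 2 * ‖f k t‖ ^ 2) (Ioi 0) :=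
    (i1.const_mul _).add (i2.const_mul _)
  rw [← integral_const_mul, ← integral_const_mul, ← integral_const_mul,
    ← integral_add (i1.const_mul _) (i2.const_mul _), ← integral_sub i4 (i3.const_mul _)]
  refine setIntegral_mono_on (integrableOn_comp_norm_mul_norm hg hg0 hgC (hv k) (hfm k))
    (i4.sub (i3.const_mul _)) measurableSet_Ioi fun t ht => ?_
  have h1 := profileSpeed_sq hμ hω (norm_nonneg (f k t)) (hpeak k t (le_of_lt ht))
  -- Young's inequality; by `h1` the square of the speed is exactly twice the potential part of the
  -- action density.
  have h2 := two_mul_le_add_sq (profileSpeed μ ω ‖f k t‖) ‖v k t‖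
  have h3 : 1 / (2 * μ + 2) * ‖f k t‖ ^ (2 * μ + 2)
      = 1 / 2 * (‖f k t‖ ^ (2 * μ + 2) / (μ + 1)) := by field_simp
  rw [h3]
  linarith

end Family

/-- Bernoulli's inequality with exponent μ+1 at the base l². On a ray through the Nehari manifold
the action is a nonnegative multiple of the left side, so its maximum is at l = 1. -/
theorem sq_sub_rpow_le {μ l : ℝ} (hμ : 0 < μ) (hl : 0 ≤ l) :
    1 / 2 * l ^ 2 - 1 / (2 * μ + 2) * l ^ (2 * μ + 2) ≤ 1 / 2 - 1 / (2 * μ + 2) := by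
  have h := one_add_mul_self_le_rpow_one_add (s := l ^ 2 - 1) (by nlinarith [sq_nonneg l])
    (p := μ + 1) (by linarith)
  have e : (1 + (l ^ 2 - 1)) ^ (μ + 1) = l ^ (2 * μ + 2) := by
    rw [add_sub_cancel, ← Real.rpow_natCast, ← Real.rpow_mul hl]
    congr 1
    push_cast
    ring
  rw [e] at h
  have h' : 1 / (2 * μ + 2) * (1 + (μ + 1) * (l ^ 2 - 1)) ≤ 1 / (2 * μ + 2) * l ^ (2 * μ + 2) := by
    gcongr
  have e2 : 1 / (2 * μ + 2) * (1 + (μ + 1) * (l ^ 2 - 1))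
      = 1 / (2 * μ + 2) + 1 / 2 * (l ^ 2 - 1) := by
    field_simp
  linarith

/-- The lower bound for the action on the Nehari manifold. -/
theorem two_mul_primitive_le_action {N : ℕ} (hN : 2 ≤ N) {μ ω : ℝ} (hμ : 0 < μ) (hω : 0 < ω)
    {Ψ : EnergySpace N} (hΨ : Ψ ∈ nehari N μ ω) :
    2 * ∫ s in (0 : ℝ)..peak μ ω, profileSpeed μ ω s ≤ action μ ω Ψ := by
  obtain ⟨hne, hI⟩ := hΨ
  obtain ⟨c, hc⟩ := exists_rep Ψ
  set v : Fin N → ℝ → ℂ := fun i => der (edge Ψ i) with hvdef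
  set f : Fin N → ℝ → ℂ := fun i x => c + ∫ t in (0 : ℝ)..x, v i t with hfdef
  have hv : ∀ i, MemLp (v i) 2 (volume.restrict (Ioi (0 : ℝ))) := fun i => Lp.memLp _
  have hfm : ∀ i, MemLp (f i) 2 (volume.restrict (Ioi (0 : ℝ))) := fun i =>
    (memLp_congr_ae (hc i)).1 (Lp.memLp _)
  have hfc : ∀ i, f i 0 = c := fun i => by simp [hfdef]
  have hf : ∀ i x, 0 ≤ x → f i x = f i 0 + ∫ t in (0 : ℝ)..x, v i t := fun i x _ => by
    rw [hfc]
  have hA : normSqDeriv Ψ = ∑ k, ∫ t in Ioi (0 : ℝ), ‖v k t‖ ^ 2 :=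
    Finset.sum_congr rfl fun k _ => sq_norm_eq_integral _
  have hM : normSq Ψ = ∑ k, ∫ t in Ioi (0 : ℝ), ‖f k t‖ ^ 2 := by
    refine Finset.sum_congr rfl fun k _ => ?_
    rw [sq_norm_eq_integral]
    refine integral_congr_ae ?_
    filter_upwards [hc k] with x hx
    rw [hx]
  have hB : normPow μ Ψ = ∑ k, ∫ t in Ioi (0 : ℝ), ‖f k t‖ ^ (2 * μ + 2) := by
    refine Finset.sum_congr rfl fun k _ => ?_
    refine integral_congr_ae ?_
    filter_upwards [hc k] with x hx
    rw [hx]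
  set S : Set ℝ := {r | ∃ i x, 0 ≤ x ∧ r = ‖f i x‖} with hS
  have hSne : S.Nonempty := ⟨_, ⟨0, by omega⟩, 0, le_rfl, rfl⟩
  have hSb : BddAbove S := by
    choose C hC using fun i => exists_norm_le (hv i) (hfm i) (hf i)
    refine ⟨∑ i, |C i|, ?_⟩
    rintro r ⟨i, x, hx, rfl⟩
    exact (hC i x hx).trans ((le_abs_self _).trans
      (Finset.single_le_sum (f := fun i => |C i|) (fun _ _ => abs_nonneg _) (Finset.mem_univ i)))
  set m := sSup S with hm
  have hfm' : ∀ i x, 0 ≤ x → ‖f i x‖ ≤ m := fun i x hx => le_csSup hSb ⟨i, x, hx, rfl⟩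
  have hm0 : 0 < m := by
    by_contra! hle
    have hz : ∀ i x, 0 ≤ x → ‖f i x‖ = 0 := fun i x hx =>
      le_antisymm ((hfm' i x hx).trans hle) (norm_nonneg _)
    have hB0 : normPow μ Ψ = 0 := by
      rw [hB]
      refine Finset.sum_eq_zero fun k _ => setIntegral_eq_zero_of_forall_eq_zero fun t ht => ?_
      rw [hz k t (le_of_lt ht), Real.zero_rpow (by positivity)]
    have hM0 : normSq Ψ = 0 := by
      rw [hM]
      refine Finset.sum_eq_zero fun k _ => setIntegral_eq_zero_of_forall_eq_zero fun t ht => ?_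
      rw [hz k t (le_of_lt ht)]
      norm_num
    have hA0 : normSqDeriv Ψ = 0 := by
      unfold nehariFunctional at hI
      rw [hB0, hM0] at hI
      linarith
    apply hne
    have e1 : ∀ i, val (edge Ψ i) = 0 := fun i => by
      have := (Finset.sum_eq_zero_iff_of_nonneg fun i _ => by positivity).1 hM0 i
        (Finset.mem_univ i)
      simpa using this
    have e2 : ∀ i, der (edge Ψ i) = 0 := fun i => by
      have := (Finset.sum_eq_zero_iff_of_nonneg fun i _ => by positivity).1 hA0 i
        (Finset.mem_univ i)
      simpa using this
    apply Subtype.ext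
    refine PiLp.ext fun i => Subtype.ext ?_
    exact WithLp.ofLp_injective 2 (Prod.ext (e1 i) (e2 i))
  -- This factor lifts or lowers the supremum of the modulus exactly to the peak, the largest
  -- amplitude for which the path bound is available.
  set l : ℝ := peak μ ω / m with hl
  have hl0 : 0 < l := div_pos (peak_pos hμ hω) hm0
  have hnorm : ∀ z : ℂ, ‖(l : ℂ) * z‖ = l * ‖z‖ := fun z => by
    rw [norm_mul, Complex.norm_of_nonneg hl0.le]
  have hscaled : ∀ i x, 0 ≤ x → 2 * ∫ s in (0 : ℝ)..l * ‖f i x‖, profileSpeed μ ω s ≤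
      1 / 2 * (l ^ 2 * normSqDeriv Ψ) + ω / 2 * (l ^ 2 * normSq Ψ)
        - 1 / (2 * μ + 2) * (l ^ (2 * μ + 2) * normPow μ Ψ) := by
    intro i x hx
    have h := two_mul_primitive_profileSpeed_le (f := fun i x => (l : ℂ) * f i x)
      (v := fun i x => (l : ℂ) * v i x) hN hμ hω (fun i => (hv i).const_mul _)
      (fun i => (hfm i).const_mul _)
      (fun i x hx => by
        rw [intervalIntegral.integral_const_mul, hf i x hx]; ring)
      (fun i j => by rw [hfc, hfc])
      (fun i x hx => by
        rw [hnorm]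
        calc l * ‖f i x‖ ≤ l * m := by gcongr; exact hfm' i x hx
          _ = peak μ ω := div_mul_cancel₀ _ hm0.ne') i hx
    simp_rw [hnorm, mul_pow, Real.mul_rpow hl0.le (norm_nonneg _), integral_const_mul,
      ← Finset.mul_sum] at h
    rw [hA, hM, hB]
    exact h
  set R := 1 / 2 * (l ^ 2 * normSqDeriv Ψ) + ω / 2 * (l ^ 2 * normSq Ψ)
        - 1 / (2 * μ + 2) * (l ^ (2 * μ + 2) * normPow μ Ψ) with hR
  -- Whether the supremum m is attained is left open: the bound holds at every value of the modulus
  -- and is a closed condition, so it passes to m.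
  have hclosed : IsClosed {r : ℝ | 2 * ∫ s in (0 : ℝ)..l * r, profileSpeed μ ω s ≤ R} := by
    refine isClosed_le (continuous_const.mul ?_) continuous_const
    exact (continuous_primitive_of_continuous (continuous_profileSpeed hμ ω) 0).comp
      (continuous_const.mul continuous_id)
  have hmem : m ∈ {r : ℝ | 2 * ∫ s in (0 : ℝ)..l * r, profileSpeed μ ω s ≤ R} := by
    refine closure_minimal ?_ hclosed (csSup_mem_closure hSne hSb)
    rintro r ⟨i, x, hx, rfl⟩
    exact hscaled i x hx
  have hlm : l * m = peak μ ω := div_mul_cancel₀ _ hm0.ne'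
  have hfin : 2 * ∫ s in (0 : ℝ)..peak μ ω, profileSpeed μ ω s ≤ R := by
    rw [← hlm]; exact hmem
  have hI' : normSqDeriv Ψ + ω * normSq Ψ = normPow μ Ψ := by
    unfold nehariFunctional at hI
    linarith
  have hB0 : 0 ≤ normPow μ Ψ := by
    rw [hB]
    exact Finset.sum_nonneg fun k _ => integral_nonneg fun t => by positivity
  -- The Nehari identity lets the quadratic part be replaced by the nonlinear one, which reduces the
  -- action on the ray to a function of l times `normPow μ Ψ`.
  have h1 : R = (1 / 2 * l ^ 2 - 1 / (2 * μ + 2) * l ^ (2 * μ + 2)) * normPow μ Ψ := by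
    rw [hR, sub_mul, ← hI']
    ring
  have h2 : action μ ω Ψ = (1 / 2 - 1 / (2 * μ + 2)) * normPow μ Ψ := by
    unfold action energy mass
    rw [sub_mul, ← hI']
    ring
  rw [h2]
  refine hfin.trans (h1.le.trans ?_)
  exact mul_le_mul_of_nonneg_right (sq_sub_rpow_le hμ hl0.le) hB0

/-! ### Decay and integrals of powers of the hyperbolic secant -/

/-- The hyperbolic secant. -/
noncomputable def sech (y : ℝ) : ℝ := 1 / Real.cosh y

theorem sech_pos (y : ℝ) : 0 < sech y := one_div_pos.2 (Real.cosh_pos y)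

theorem sech_le_one (y : ℝ) : sech y ≤ 1 := by
  unfold sech
  rw [div_le_one (Real.cosh_pos y)]
  exact Real.one_le_cosh y

theorem sech_abs (y : ℝ) : sech |y| = sech y := by
  unfold sech
  rw [Real.cosh_abs]

theorem sech_le_two_mul_exp (y : ℝ) : sech y ≤ 2 * Real.exp (-y) := by
  unfold sech
  rw [div_le_iff₀ (Real.cosh_pos y), Real.cosh_eq]
  have h : Real.exp (-y) * Real.exp y = 1 := by rw [← Real.exp_add]; simp
  nlinarith [Real.exp_pos (-y), Real.exp_pos y]

theorem sech_le_two_mul_exp' (y : ℝ) : sech y ≤ 2 * Real.exp y := by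
  have h := sech_le_two_mul_exp (-y)
  rw [neg_neg] at h
  have h2 : sech (-y) = sech y := by unfold sech; rw [Real.cosh_neg]
  rwa [h2] at h

theorem tanh_sq_add_sech_sq (y : ℝ) : Real.tanh y ^ 2 + sech y ^ 2 = 1 := by
  have h := Real.cosh_sq y
  have h' := (Real.cosh_pos y).ne'
  unfold sech
  rw [Real.tanh_eq_sinh_div_cosh]
  field_simp
  linarith

theorem abs_tanh_le_one (y : ℝ) : |Real.tanh y| ≤ 1 := by
  rw [← sq_le_one_iff_abs_le_one]
  nlinarith [tanh_sq_add_sech_sq y, sq_nonneg (sech y)]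

theorem tanh_nonneg {y : ℝ} (hy : 0 ≤ y) : 0 ≤ Real.tanh y := by
  rw [Real.tanh_eq_sinh_div_cosh]
  exact div_nonneg (Real.sinh_nonneg_iff.2 hy) (Real.cosh_pos y).le

theorem hasDerivAt_tanh_mul (k x : ℝ) :
    HasDerivAt (fun x => Real.tanh (k * x)) (k * sech (k * x) ^ 2) x := by
  have h' := (Real.cosh_pos (k * x)).ne'
  have hk : HasDerivAt (fun x => k * x) k x := by simpa using (hasDerivAt_id x).const_mul k
  have h : HasDerivAt (fun x => Real.sinh (k * x) / Real.cosh (k * x)) _ x :=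
    hk.sinh.fun_div hk.cosh h'
  simp_rw [Real.tanh_eq_sinh_div_cosh]
  convert! h using 1
  have e := Real.cosh_sq (k * x)
  unfold sech
  field_simp
  linear_combination -k * e

theorem hasDerivAt_sech_rpow (k p x : ℝ) :
    HasDerivAt (fun x => sech (k * x) ^ p)
      (-(p * k * sech (k * x) ^ p * Real.tanh (k * x))) x := by
  have h' := (Real.cosh_pos (k * x)).ne'
  have hk : HasDerivAt (fun x => k * x) k x := by simpa using (hasDerivAt_id x).const_mul k
  have h1 : HasDerivAt (fun x => sech (k * x)) (-(k * sech (k * x) * Real.tanh (k * x))) x := by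
    have h : HasDerivAt (fun x => (Real.cosh (k * x))⁻¹) _ x := hk.cosh.fun_inv h'
    unfold sech
    simp_rw [one_div]
    convert! h using 1
    rw [Real.tanh_eq_sinh_div_cosh]
    field_simp
  have h2 := h1.rpow_const (p := p) (Or.inl (sech_pos (k * x)).ne')
  convert! h2 using 1
  rw [Real.rpow_sub_one (sech_pos _).ne']
  have := (sech_pos (k * x)).ne'
  field_simp

theorem continuous_sech_rpow (k p : ℝ) : Continuous fun x => sech (k * x) ^ p :=
  continuous_iff_continuousAt.2 fun x => (hasDerivAt_sech_rpow k p x).continuousAt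

theorem continuous_tanh_mul (k : ℝ) : Continuous fun x => Real.tanh (k * x) :=
  continuous_iff_continuousAt.2 fun x => (hasDerivAt_tanh_mul k x).continuousAt

theorem sech_rpow_le_exp {p : ℝ} (hp : 0 ≤ p) (y : ℝ) :
    sech y ^ p ≤ 2 ^ p * Real.exp (-(p * y)) := by
  refine (Real.rpow_le_rpow (sech_pos y).le (sech_le_two_mul_exp y) hp).trans_eq ?_
  rw [Real.mul_rpow (by norm_num) (Real.exp_pos _).le, ← Real.exp_mul]
  ring_nf

theorem sech_rpow_le_exp' {p : ℝ} (hp : 0 ≤ p) (y : ℝ) :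
    sech y ^ p ≤ 2 ^ p * Real.exp (p * y) := by
  refine (Real.rpow_le_rpow (sech_pos y).le (sech_le_two_mul_exp' y) hp).trans_eq ?_
  rw [Real.mul_rpow (by norm_num) (Real.exp_pos _).le, ← Real.exp_mul]
  ring_nf

theorem integrable_sech_rpow {k p : ℝ} (hk : 0 < k) (hp : 0 < p) :
    Integrable fun x => sech (k * x) ^ p := by
  have hpk : 0 < p * k := mul_pos hp hk
  rw [← integrableOn_univ, ← Iic_union_Ioi (a := (0 : ℝ))]
  refine IntegrableOn.union ?_ ?_
  · refine Integrable.mono' ((integrableOn_exp_mul_Iic hpk 0).const_mul (2 ^ p))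
      (continuous_sech_rpow k p).aestronglyMeasurable (ae_of_all _ fun x => ?_)
    rw [Real.norm_of_nonneg (Real.rpow_nonneg (sech_pos _).le _)]
    refine (sech_rpow_le_exp' hp.le _).trans_eq ?_
    ring_nf
  · refine Integrable.mono' ((exp_neg_integrableOn_Ioi 0 hpk).const_mul (2 ^ p))
      (continuous_sech_rpow k p).aestronglyMeasurable (ae_of_all _ fun x => ?_)
    rw [Real.norm_of_nonneg (Real.rpow_nonneg (sech_pos _).le _)]
    refine (sech_rpow_le_exp hp.le _).trans_eq ?_
    ring_nf

theorem tendsto_sech_rpow_atTop {k p : ℝ} (hk : 0 < k) (hp : 0 < p) :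
    Tendsto (fun x => sech (k * x) ^ p) atTop (𝓝 0) := by
  have h : Tendsto (fun x : ℝ => 2 ^ p * Real.exp (-(p * (k * x)))) atTop (𝓝 (2 ^ p * 0)) := by
    refine (Real.tendsto_exp_atBot.comp (tendsto_neg_atTop_atBot.comp ?_)).const_mul _
    exact (tendsto_id.const_mul_atTop hk).const_mul_atTop hp
  rw [mul_zero] at h
  exact squeeze_zero (fun x => Real.rpow_nonneg (sech_pos _).le _)
    (fun x => sech_rpow_le_exp hp.le _) h

theorem tendsto_sech_rpow_atBot {k p : ℝ} (hk : 0 < k) (hp : 0 < p) :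
    Tendsto (fun x => sech (k * x) ^ p) atBot (𝓝 0) := by
  have h := (tendsto_sech_rpow_atTop hk hp).comp tendsto_neg_atBot_atTop
  refine h.congr fun x => ?_
  have : sech (-(k * x)) = sech (k * x) := by unfold sech; rw [Real.cosh_neg]
  simp only [Function.comp_apply, mul_neg, this]

theorem tendsto_tanh_mul_atTop {k : ℝ} (hk : 0 < k) :
    Tendsto (fun x => Real.tanh (k * x)) atTop (𝓝 1) := by
  have h := ((tendsto_sech_rpow_atTop hk (p := 2) two_pos).const_sub 1).sqrt
  rw [sub_zero, Real.sqrt_one] at h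
  refine h.congr' ?_
  filter_upwards [eventually_ge_atTop 0] with x hx
  have e := tanh_sq_add_sech_sq (k * x)
  rw [Real.rpow_two, ← e, add_sub_cancel_right, Real.sqrt_sq (tanh_nonneg (by positivity))]

theorem sech_rpow_add_two (p y : ℝ) : sech y ^ (p + 2) = sech y ^ p * sech y ^ 2 := by
  rw [Real.rpow_add (sech_pos y), Real.rpow_two]

theorem integrable_sech_rpow_mul_tanh_sq {k p : ℝ} (hk : 0 < k) (hp : 0 < p) :
    Integrable fun x => sech (k * x) ^ p * Real.tanh (k * x) ^ 2 := by
  refine ((integrable_sech_rpow hk hp).sub (integrable_sech_rpow hk (p := p + 2)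
    (by positivity))).congr (ae_of_all _ fun x => ?_)
  have e := tanh_sq_add_sech_sq (k * x)
  simp only [Pi.sub_apply]
  rw [sech_rpow_add_two]
  linear_combination (sech (k * x) ^ p) * (-e)

/-- The derivative of sech^p · tanh is k times the difference of the two integrands, and its
integral over the line vanishes because sech^p tends to 0 at both ends while tanh is bounded. -/
theorem integral_sech_rpow_add_two {k p : ℝ} (hk : 0 < k) (hp : 0 < p) :
    ∫ x, sech (k * x) ^ (p + 2) = p * ∫ x, sech (k * x) ^ p * Real.tanh (k * x) ^ 2 := by
  have i1 := integrable_sech_rpow hk (p := p + 2) (by positivity)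
  have i2 := integrable_sech_rpow_mul_tanh_sq hk hp
  have hd : ∀ x, HasDerivAt (fun x => sech (k * x) ^ p * Real.tanh (k * x))
      (k * sech (k * x) ^ (p + 2) - p * k * (sech (k * x) ^ p * Real.tanh (k * x) ^ 2)) x := by
    intro x
    convert! (hasDerivAt_sech_rpow k p x).fun_mul (hasDerivAt_tanh_mul k x) using 1
    rw [sech_rpow_add_two]
    ring
  have hle : ∀ x, |sech (k * x) ^ p * Real.tanh (k * x)| ≤ sech (k * x) ^ p := fun x => by
    have h0 := Real.rpow_nonneg (sech_pos (k * x)).le p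
    rw [abs_mul, abs_of_nonneg h0]
    exact mul_le_of_le_one_right h0 (abs_tanh_le_one _)
  have h := integral_of_hasDerivAt_of_tendsto hd ((i1.const_mul k).sub (i2.const_mul (p * k)))
    (squeeze_zero_norm hle (tendsto_sech_rpow_atBot hk hp))
    (squeeze_zero_norm hle (tendsto_sech_rpow_atTop hk hp))
  rw [integral_sub (i1.const_mul k) (i2.const_mul (p * k)), integral_const_mul, integral_const_mul,
    sub_zero] at h
  have h2 : k * ((∫ x, sech (k * x) ^ (p + 2))
      - p * ∫ x, sech (k * x) ^ p * Real.tanh (k * x) ^ 2) = 0 := by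
    linear_combination h
  exact sub_eq_zero.1 ((mul_eq_zero.1 h2).resolve_left hk.ne')

/-- Evenness reduces to the half-line, where t = tanh(kx) and 1 - t² = sech² turn (1 - t²)^p dt into
k sech^(2p+2)(kx) dx. -/
theorem integral_sech_rpow_eq {k p : ℝ} (hk : 0 < k) (hp : 0 < p) :
    ∫ x, sech (k * x) ^ (2 * p + 2) = 2 / k * ∫ t in (0 : ℝ)..1, (1 - t ^ 2) ^ p := by
  have e1 : ∀ x, sech (k * x) ^ (2 * p + 2) = sech (k * |x|) ^ (2 * p + 2) := fun x => by
    rw [← sech_abs (k * x), abs_mul, abs_of_pos hk]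
  rw [integral_congr_ae (ae_of_all _ e1), integral_comp_abs (f := fun x => sech (k * x) ^ (2 * p + 2))]
  have hc : Continuous fun t : ℝ => (1 - t ^ 2) ^ p :=
    (continuous_const.sub (continuous_pow 2)).rpow_const fun _ => Or.inr hp.le
  have hd : ∀ x ∈ Ici (0 : ℝ), HasDerivAt
      (fun x => ∫ t in (0 : ℝ)..Real.tanh (k * x), (1 - t ^ 2) ^ p)
      (k * sech (k * x) ^ (2 * p + 2)) x := by
    intro x _
    have h1 := intervalIntegral.integral_hasDerivAt_right
      (hc.intervalIntegrable (μ := volume) 0 (Real.tanh (k * x)))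
      (hc.stronglyMeasurableAtFilter _ _) hc.continuousAt
    convert! h1.comp x (hasDerivAt_tanh_mul k x) using 1
    have e : 1 - Real.tanh (k * x) ^ 2 = sech (k * x) ^ 2 := by
      linarith [tanh_sq_add_sech_sq (k * x)]
    rw [e, sech_rpow_add_two, ← Real.rpow_natCast, ← Real.rpow_mul (sech_pos _).le]
    push_cast
    ring_nf
  have hlim : Tendsto (fun x => ∫ t in (0 : ℝ)..Real.tanh (k * x), (1 - t ^ 2) ^ p) atTop
      (𝓝 (∫ t in (0 : ℝ)..1, (1 - t ^ 2) ^ p)) :=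
    ((intervalIntegral.continuous_primitive (fun _ _ => hc.intervalIntegrable _ _) 0).tendsto
      1).comp (tendsto_tanh_mul_atTop hk)
  have h := integral_Ioi_of_hasDerivAt_of_nonneg' hd
    (fun x _ => mul_nonneg hk.le (Real.rpow_nonneg (sech_pos _).le _)) hlim
  rw [integral_const_mul] at h
  rw [mul_zero, Real.tanh_zero, intervalIntegral.integral_same, sub_zero] at h
  rw [← h]
  field_simp

/-! ### The soliton on the line -/

section Soliton

variable {μ ω : ℝ}

theorem soliton_eq (μ ω x : ℝ) :
    soliton μ ω x = peak μ ω * sech (μ * √ω * x) ^ (1 / μ) := rfl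

theorem soliton_pos (hμ : 0 < μ) (hω : 0 < ω) (x : ℝ) : 0 < soliton μ ω x := by
  rw [soliton_eq]
  exact mul_pos (peak_pos hμ hω) (Real.rpow_pos_of_pos (sech_pos _) _)

theorem soliton_le_peak (hμ : 0 < μ) (hω : 0 < ω) (x : ℝ) : soliton μ ω x ≤ peak μ ω := by
  rw [soliton_eq]
  exact mul_le_of_le_one_right (peak_pos hμ hω).le
    (Real.rpow_le_one (sech_pos _).le (sech_le_one _) (by positivity))

theorem hasDerivAt_soliton (hμ : 0 < μ) (x : ℝ) :
    HasDerivAt (soliton μ ω) (-(√ω * soliton μ ω x * Real.tanh (μ * √ω * x))) x := by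
  have h := (hasDerivAt_sech_rpow (μ * √ω) (1 / μ) x).const_mul (peak μ ω)
  convert! h using 1
  rw [soliton_eq]
  field_simp

theorem deriv_soliton (hμ : 0 < μ) :
    deriv (soliton μ ω) = fun x => -(√ω * soliton μ ω x * Real.tanh (μ * √ω * x)) :=
  funext fun x => (hasDerivAt_soliton hμ x).deriv

theorem continuous_soliton (hμ : 0 < μ) : Continuous (soliton μ ω) :=
  continuous_iff_continuousAt.2 fun x => (hasDerivAt_soliton hμ x).continuousAt

theorem contDiff_soliton (hμ : 0 < μ) : ContDiff ℝ 1 (soliton μ ω) := by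
  rw [contDiff_one_iff_deriv, deriv_soliton hμ]
  refine ⟨fun x => (hasDerivAt_soliton hμ x).differentiableAt, ?_⟩
  exact ((continuous_const.mul (continuous_soliton hμ)).mul (continuous_tanh_mul _)).neg

theorem abs_deriv_soliton_le (hμ : 0 < μ) (hω : 0 < ω) (x : ℝ) :
    |deriv (soliton μ ω) x| ≤ √ω * soliton μ ω x := by
  rw [deriv_soliton hμ, abs_neg, abs_mul,
    abs_of_nonneg (mul_nonneg (Real.sqrt_nonneg _) (soliton_pos hμ hω x).le)]
  exact mul_le_of_le_one_right (mul_nonneg (Real.sqrt_nonneg _) (soliton_pos hμ hω x).le)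
    (abs_tanh_le_one _)

theorem soliton_sq (μ ω x : ℝ) : soliton μ ω x ^ 2
    = peak μ ω ^ 2 * sech (μ * √ω * x) ^ (2 / μ) := by
  rw [soliton_eq, mul_pow, ← Real.rpow_natCast (_ ^ (1 / μ)), ← Real.rpow_mul (sech_pos _).le]
  congr 2
  push_cast
  ring

theorem soliton_rpow (hμ : 0 < μ) (hω : 0 < ω) (x : ℝ) : soliton μ ω x ^ (2 * μ + 2)
    = (μ + 1) * ω * peak μ ω ^ 2 * sech (μ * √ω * x) ^ (2 / μ + 2) := by
  rw [Real.rpow_add (soliton_pos hμ hω x), Real.rpow_two, soliton_sq, soliton_eq,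
    Real.mul_rpow (peak_pos hμ hω).le (Real.rpow_nonneg (sech_pos _).le _), peak_rpow hμ hω,
    ← Real.rpow_mul (sech_pos _).le, show 1 / μ * (2 * μ) = 2 by field_simp, Real.rpow_two,
    sech_rpow_add_two]
  ring

theorem deriv_soliton_sq (hμ : 0 < μ) (hω : 0 < ω) (x : ℝ) : deriv (soliton μ ω) x ^ 2
    = ω * peak μ ω ^ 2 * (sech (μ * √ω * x) ^ (2 / μ) * Real.tanh (μ * √ω * x) ^ 2) := by
  rw [deriv_soliton hμ, neg_sq, mul_pow, mul_pow, Real.sq_sqrt hω.le, soliton_sq]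
  ring

/-- The zero-energy first integral φ'² = ωφ² - φ^(2μ+2)/(μ+1), with the sign fixed by monotonicity
on x ≥ 0. It makes Young's inequality an equality along the soliton. -/
theorem profileSpeed_soliton (hμ : 0 < μ) (hω : 0 < ω) {x : ℝ} (hx : 0 ≤ x) :
    profileSpeed μ ω (soliton μ ω x) = -deriv (soliton μ ω) x := by
  have h1 : 0 ≤ -deriv (soliton μ ω) x := by
    rw [deriv_soliton hμ, neg_neg]
    exact mul_nonneg (mul_nonneg (Real.sqrt_nonneg _) (soliton_pos hμ hω x).le)
      (tanh_nonneg (by positivity))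
  have h2 := profileSpeed_sq hμ hω (soliton_pos hμ hω x).le (soliton_le_peak hμ hω x)
  refine (sq_eq_sq₀ (profileSpeed_nonneg _ _ _) h1).1 ?_
  rw [h2, neg_sq, deriv_soliton_sq hμ hω, soliton_sq, soliton_rpow hμ hω, sech_rpow_add_two]
  have e := tanh_sq_add_sech_sq (μ * √ω * x)
  field_simp
  linear_combination (-(peak μ ω ^ 2 * sech (μ * √ω * x) ^ (2 / μ))) * e

theorem integrable_soliton (hμ : 0 < μ) (hω : 0 < ω) : Integrable (soliton μ ω) :=
  (integrable_sech_rpow (mul_pos hμ (Real.sqrt_pos.2 hω)) (by positivity)).const_mul _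

theorem integrable_soliton_sq (hμ : 0 < μ) (hω : 0 < ω) :
    Integrable fun x => soliton μ ω x ^ 2 := by
  simp_rw [soliton_sq]
  exact (integrable_sech_rpow (mul_pos hμ (Real.sqrt_pos.2 hω)) (by positivity)).const_mul _

theorem integrable_deriv_soliton_sq (hμ : 0 < μ) (hω : 0 < ω) :
    Integrable fun x => deriv (soliton μ ω) x ^ 2 := by
  simp_rw [deriv_soliton_sq hμ hω]
  exact (integrable_sech_rpow_mul_tanh_sq (mul_pos hμ (Real.sqrt_pos.2 hω))
    (by positivity)).const_mul _

theorem integrable_soliton_rpow (hμ : 0 < μ) (hω : 0 < ω) :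
    Integrable fun x => soliton μ ω x ^ (2 * μ + 2) := by
  simp_rw [soliton_rpow hμ hω]
  exact (integrable_sech_rpow (mul_pos hμ (Real.sqrt_pos.2 hω)) (by positivity)).const_mul _

/-- Together with `integral_soliton_sq`, this expresses every term of the action through ∫ φ'²;
since 1 + (μ+2)/μ = 2(μ+1)/μ, the two identities also contain the Nehari identity on the line. -/
theorem integral_soliton_rpow (hμ : 0 < μ) (hω : 0 < ω) :
    ∫ x, soliton μ ω x ^ (2 * μ + 2)
      = 2 * (μ + 1) / μ * ∫ x, deriv (soliton μ ω) x ^ 2 := by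
  simp_rw [soliton_rpow hμ hω, deriv_soliton_sq hμ hω]
  rw [integral_const_mul, integral_const_mul,
    integral_sech_rpow_add_two (mul_pos hμ (Real.sqrt_pos.2 hω)) (by positivity)]
  ring

theorem integral_soliton_sq (hμ : 0 < μ) (hω : 0 < ω) :
    ω * ∫ x, soliton μ ω x ^ 2 = (μ + 2) / μ * ∫ x, deriv (soliton μ ω) x ^ 2 := by
  have hk := mul_pos hμ (Real.sqrt_pos.2 hω)
  have h2 : 0 < 2 / μ := by positivity
  have e : ∀ x, soliton μ ω x ^ 2 = peak μ ω ^ 2 *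
      (sech (μ * √ω * x) ^ (2 / μ) * Real.tanh (μ * √ω * x) ^ 2
        + sech (μ * √ω * x) ^ (2 / μ + 2)) := fun x => by
    rw [soliton_sq, sech_rpow_add_two, ← mul_add, tanh_sq_add_sech_sq, mul_one]
  simp_rw [e, deriv_soliton_sq hμ hω]
  rw [integral_const_mul, integral_const_mul,
    integral_add (integrable_sech_rpow_mul_tanh_sq hk h2)
      (integrable_sech_rpow hk (by positivity)), integral_sech_rpow_add_two hk h2]
  field_simp

theorem peak_sq (hμ : 0 < μ) (hω : 0 < ω) :
    peak μ ω ^ 2 = (μ + 1) ^ (1 / μ) * ω ^ (1 / μ) := by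
  unfold peak
  rw [← Real.rpow_natCast, ← Real.rpow_mul (by positivity),
    ← Real.mul_rpow (by positivity) hω.le]
  congr 1
  push_cast
  field_simp

/-- The integral of φ^(2μ+2) is computed in two ways: as a multiple of ∫ φ'² and by the tanh
substitution. -/
theorem integral_deriv_soliton_sq (hμ : 0 < μ) (hω : 0 < ω) :
    ∫ x, deriv (soliton μ ω) x ^ 2 = d0 μ ω := by
  have hk := mul_pos hμ (Real.sqrt_pos.2 hω)
  have h1 := integral_soliton_rpow hμ hω
  simp_rw [soliton_rpow hμ hω] at h1
  rw [integral_const_mul, show 2 / μ + 2 = 2 * (1 / μ) + 2 by ring,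
    integral_sech_rpow_eq hk (by positivity), peak_sq hμ hω] at h1
  unfold d0
  rw [Real.rpow_add hω, ← Real.sqrt_eq_rpow]
  have h2 : ω = √ω * √ω := (Real.mul_self_sqrt hω.le).symm
  have hs := Real.sqrt_pos.2 hω
  generalize (∫ x, deriv (soliton μ ω) x ^ 2) = D at *
  generalize (∫ t in (0 : ℝ)..1, (1 - t ^ 2) ^ (1 / μ)) = I at *
  generalize hW : ω ^ (1 / μ) = W at *
  generalize (μ + 1) ^ (1 / μ) = V at *
  generalize √ω = r at *
  subst h2
  field_simp at h1
  linear_combination -h1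

theorem tendsto_soliton_atTop (hμ : 0 < μ) (hω : 0 < ω) :
    Tendsto (soliton μ ω) atTop (𝓝 0) := by
  have h := (tendsto_sech_rpow_atTop (mul_pos hμ (Real.sqrt_pos.2 hω))
    (p := 1 / μ) (by positivity)).const_mul (peak μ ω)
  rwa [mul_zero] at h

theorem tendsto_soliton_atBot (hμ : 0 < μ) (hω : 0 < ω) :
    Tendsto (soliton μ ω) atBot (𝓝 0) := by
  have h := (tendsto_sech_rpow_atBot (mul_pos hμ (Real.sqrt_pos.2 hω))
    (p := 1 / μ) (by positivity)).const_mul (peak μ ω)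
  rwa [mul_zero] at h

/-- The lower bound for the action is the action of the soliton. -/
theorem two_mul_primitive_peak (hμ : 0 < μ) (hω : 0 < ω) :
    2 * ∫ s in (0 : ℝ)..peak μ ω, profileSpeed μ ω s = d0 μ ω := by
  have hg := continuous_profileSpeed hμ ω
  have hd : ∀ x ∈ Ici (0 : ℝ), HasDerivAt
      (fun x => -∫ s in (0 : ℝ)..soliton μ ω x, profileSpeed μ ω s)
      (deriv (soliton μ ω) x ^ 2) x := by
    intro x hx
    have h1 := intervalIntegral.integral_hasDerivAt_right
      (hg.intervalIntegrable (μ := volume) 0 (soliton μ ω x))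
      (hg.stronglyMeasurableAtFilter _ _) hg.continuousAt
    have h2 : HasDerivAt (soliton μ ω) (deriv (soliton μ ω) x) x :=
      (hasDerivAt_soliton hμ x).differentiableAt.hasDerivAt
    convert! (h1.comp x h2).neg using 1
    rw [profileSpeed_soliton hμ hω hx]
    ring
  have hlim : Tendsto (fun x => -∫ s in (0 : ℝ)..soliton μ ω x, profileSpeed μ ω s) atTop
      (𝓝 0) := by
    have := (((continuous_primitive_of_continuous hg 0).tendsto 0).comp
      (tendsto_soliton_atTop hμ hω)).neg
    simpa using this
  have h := integral_Ioi_of_hasDerivAt_of_nonneg' hd (fun x _ => sq_nonneg _) hlim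
  have h0 : soliton μ ω 0 = peak μ ω := by
    rw [soliton_eq]
    simp [sech]
  rw [zero_sub, neg_neg, h0] at h
  -- The factor 2 of the two paths matches the two halves of the line, as φ'² is even.
  rw [← h, ← integral_deriv_soliton_sq hμ hω, ← integral_comp_abs
    (f := fun x => deriv (soliton μ ω) x ^ 2)]
  refine integral_congr_ae (ae_of_all _ fun x => ?_)
  dsimp only
  rw [deriv_soliton_sq hμ hω, deriv_soliton_sq hμ hω]
  rcases abs_choice x with hx | hx
  · rw [hx]
  · rw [hx]
    simp [sech]

theorem lineAction_soliton (hμ : 0 < μ) (hω : 0 < ω) :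
    lineAction μ ω (soliton μ ω) = d0 μ ω := by
  unfold lineAction
  have e : ∀ x, |soliton μ ω x| = soliton μ ω x := fun x => abs_of_pos (soliton_pos hμ hω x)
  simp_rw [e]
  rw [div_mul_eq_mul_div ω, integral_soliton_sq hμ hω, integral_soliton_rpow hμ hω,
    integral_deriv_soliton_sq hμ hω]
  field_simp
  ring

theorem memLp_soliton (hμ : 0 < μ) (hω : 0 < ω) : MemLp (soliton μ ω) 2 volume :=
  (memLp_two_iff_integrable_sq (continuous_soliton hμ).aestronglyMeasurable).2
    (integrable_soliton_sq hμ hω)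

theorem memLp_deriv_soliton (hμ : 0 < μ) (hω : 0 < ω) :
    MemLp (deriv (soliton μ ω)) 2 volume :=
  (memLp_two_iff_integrable_sq
    ((contDiff_soliton hμ).continuous_deriv le_rfl).aestronglyMeasurable).2
    (integrable_deriv_soliton_sq hμ hω)

theorem memLp_soliton_rpow (hμ : 0 < μ) (hω : 0 < ω) :
    MemLp (soliton μ ω) (ENNReal.ofReal (2 * μ + 2)) volume := by
  have hp : (0 : ℝ) < 2 * μ + 2 := by positivity
  rw [← integrable_norm_rpow_iff (continuous_soliton hμ).aestronglyMeasurable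
    (by simpa using hp) ENNReal.ofReal_ne_top, ENNReal.toReal_ofReal hp.le]
  refine (integrable_soliton_rpow hμ hω).congr (ae_of_all _ fun x => ?_)
  simp only [Real.norm_of_nonneg (soliton_pos hμ hω x).le]

end Soliton

/-! ### The cutoff, functions on one edge, and scaling -/

/-- A cutoff on the half-line extends to a continuously differentiable function on the line that
vanishes on `(-∞, 1]`. -/
theorem IsCutoff.exists_extension {χ : ℝ → ℝ} (hχ : IsCutoff χ) :
    ∃ (η : ℝ → ℝ) (K : ℝ), ContDiff ℝ 1 η ∧ (∀ x, 0 ≤ η x ∧ η x ≤ 1) ∧ (∀ x, x ≤ 1 → η x = 0) ∧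
      (∀ x, 2 ≤ x → η x = 1) ∧ (∀ x, 0 < x → η x = χ x) ∧ (∀ x, |deriv η x| ≤ K) ∧
      ∀ x, 2 < x → deriv η x = 0 := by
  obtain ⟨h1, h2, h3, h4⟩ := hχ
  -- Nothing is known about χ on the negative half-line, so it is replaced there by 0; since χ
  -- vanishes on [0, 1], no regularity is lost at the origin.
  set η : ℝ → ℝ := fun x => if x ≤ 0 then 0 else χ x with hη
  have e0 : ∀ x, x ≤ 1 → η x = 0 := by
    intro x hx
    by_cases h : x ≤ 0
    · simp [hη, h]
    · simp [hη, h, h3 x (not_le.1 h).le hx]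
  have e1 : ∀ x, 0 < x → η x = χ x := fun x hx => by simp [hη, not_le.2 hx]
  have e2 : ∀ x, 2 ≤ x → η x = 1 := fun x hx => by rw [e1 x (by linarith), h4 x hx]
  have n0 : ∀ x, x < 1 → η =ᶠ[𝓝 x] fun _ => 0 := fun x hx => by
    filter_upwards [Iio_mem_nhds hx] with y hy using e0 y (le_of_lt hy)
  have n2 : ∀ x, 2 < x → η =ᶠ[𝓝 x] fun _ => 1 := fun x hx => by
    filter_upwards [Ioi_mem_nhds hx] with y hy using e2 y (le_of_lt hy)
  have hd : ContDiff ℝ 1 η := by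
    rw [contDiff_iff_contDiffAt]
    intro x
    rcases lt_or_ge x 1 with hx | hx
    · exact contDiffAt_const.congr_of_eventuallyEq (n0 x hx)
    · have hx0 : 0 < x := by linarith
      have h5 : ContDiffAt ℝ 1 χ x := (h1.contDiffAt (Ici_mem_nhds hx0)).of_le (by norm_cast)
      refine h5.congr_of_eventuallyEq ?_
      filter_upwards [Ioi_mem_nhds hx0] with y hy using e1 y hy
  have d2 : ∀ x, 2 < x → deriv η x = 0 := fun x hx => by rw [(n2 x hx).deriv_eq, deriv_const]
  obtain ⟨K, hK⟩ := (hd.continuous_deriv le_rfl).bounded_above_of_compact_support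
    (HasCompactSupport.intro (isCompact_Icc (a := 1) (b := 2)) fun x hx => by
      rcases lt_or_ge x 1 with h | h
      · rw [(n0 x h).deriv_eq, deriv_const]
      · exact d2 x (not_le.1 fun h' => hx ⟨h, h'⟩))
  refine ⟨η, K, hd, fun x => ?_, e0, e2, e1, hK, d2⟩
  by_cases h : x ≤ 0
  · simp [hη, h]
  · simpa [hη, h] using h2 x (not_le.1 h).le

section H1

theorem isWeakDeriv_of_contDiff {w : ℝ → ℝ} (hw : ContDiff ℝ 1 w) :
    IsWeakDeriv (fun x => (w x : ℂ)) fun x => ((deriv w x : ℝ) : ℂ) := by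
  intro φ h1 h2 h3
  have hd : Continuous (deriv φ) := h1.continuous_deriv (by simp)
  have hw' := hw.continuous_deriv le_rfl
  have key : ∫ x, w x * deriv φ x = -∫ x, deriv w x * φ x := by
    refine integral_mul_deriv_eq_deriv_mul_of_integrable
      (fun x _ => ((hw.differentiable one_ne_zero) x).hasDerivAt)
      (fun x _ => ((h1.differentiable (by simp)) x).hasDerivAt) ?_ ?_ ?_
    · exact (hw.continuous.mul hd).integrable_of_hasCompactSupport h2.deriv.mul_left
    · exact (hw'.mul h1.continuous).integrable_of_hasCompactSupport h2.mul_left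
    · exact (hw.continuous.mul h1.continuous).integrable_of_hasCompactSupport h2.mul_left
  have z : ∀ x ∉ Ioi (0 : ℝ), x ∉ tsupport φ := fun x hx h => hx (h3 h)
  rw [setIntegral_eq_integral_of_forall_compl_eq_zero fun x hx => by
      rw [image_eq_zero_of_notMem_tsupport fun h => z x hx (tsupport_deriv_subset h), zero_smul],
    setIntegral_eq_integral_of_forall_compl_eq_zero fun x hx => by
      rw [image_eq_zero_of_notMem_tsupport (z x hx), zero_smul]]
  simp_rw [Complex.real_smul, ← Complex.ofReal_mul]
  rw [integral_complex_ofReal, integral_complex_ofReal, ← Complex.ofReal_neg]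
  simp_rw [mul_comm (deriv φ _), mul_comm (φ _)]
  rw [key]

theorem IsWeakDeriv.congr_ae {u v u' v' : ℝ → ℂ} (h : IsWeakDeriv u v)
    (hu : u' =ᵐ[volume.restrict (Ioi (0 : ℝ))] u) (hv : v' =ᵐ[volume.restrict (Ioi (0 : ℝ))] v) :
    IsWeakDeriv u' v' := by
  intro φ h1 h2 h3
  have e1 : ∫ x in Ioi (0 : ℝ), deriv φ x • u' x = ∫ x in Ioi (0 : ℝ), deriv φ x • u x := by
    refine integral_congr_ae ?_
    filter_upwards [hu] with x hx
    rw [hx]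
  have e2 : ∫ x in Ioi (0 : ℝ), φ x • v' x = ∫ x in Ioi (0 : ℝ), φ x • v x := by
    refine integral_congr_ae ?_
    filter_upwards [hv] with x hx
    rw [hx]
  rw [e1, e2, h φ h1 h2 h3]

/-- A continuously differentiable function as an element of `H¹(ℝ⁺)`. -/
theorem exists_H1Half_of_contDiff {w : ℝ → ℝ} (hw : ContDiff ℝ 1 w)
    (h1 : MemLp (fun x => (w x : ℂ)) 2 (volume.restrict (Ioi (0 : ℝ))))
    (h2 : MemLp (fun x => ((deriv w x : ℝ) : ℂ)) 2 (volume.restrict (Ioi (0 : ℝ)))) :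
    ∃ u : H1Half, val u =ᵐ[volume.restrict (Ioi (0 : ℝ))] (fun x => (w x : ℂ)) ∧
      der u =ᵐ[volume.restrict (Ioi (0 : ℝ))] fun x => ((deriv w x : ℝ) : ℂ) :=
  ⟨⟨WithLp.toLp 2 (h1.toLp _, h2.toLp _),
    (isWeakDeriv_of_contDiff hw).congr_ae h1.coeFn_toLp h2.coeFn_toLp⟩,
    h1.coeFn_toLp, h2.coeFn_toLp⟩

variable {N : ℕ}

/-- The element of the energy space that is `u` on the edge `j` and vanishes on the others. -/
noncomputable def singleEdge (j : Fin N) (u : H1Half) (hu : HasValueAtZero u 0) : EnergySpace N :=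
  ⟨WithLp.toLp 2 (Pi.single j u), 0, fun i => by
    rcases eq_or_ne i j with rfl | h
    · simpa using hu
    · have : (WithLp.toLp 2 (Pi.single j u) : H1Graph N) i = 0 := by simp [h]
      rw [this]
      exact ⟨0, continuousOn_const, Lp.coeFn_zero _ _ _, rfl⟩⟩

theorem edge_singleEdge_self (j : Fin N) (u : H1Half) (hu : HasValueAtZero u 0) :
    edge (singleEdge j u hu) j = u := by
  simp [edge, singleEdge]

theorem edge_singleEdge_of_ne {i j : Fin N} (h : i ≠ j) (u : H1Half) (hu : HasValueAtZero u 0) :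
    edge (singleEdge j u hu) i = 0 := by
  simp [edge, singleEdge, h]

theorem val_zero : val 0 = 0 := rfl

theorem der_zero : der 0 = 0 := rfl

theorem normSq_singleEdge (j : Fin N) (u : H1Half) (hu : HasValueAtZero u 0) :
    normSq (singleEdge j u hu) = ∫ x in Ioi (0 : ℝ), ‖val u x‖ ^ 2 := by
  unfold normSq
  rw [Finset.sum_eq_single j, edge_singleEdge_self, sq_norm_eq_integral]
  · intro i _ hi
    rw [edge_singleEdge_of_ne hi, val_zero]
    simp
  · simp

theorem normSqDeriv_singleEdge (j : Fin N) (u : H1Half) (hu : HasValueAtZero u 0) :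
    normSqDeriv (singleEdge j u hu) = ∫ x in Ioi (0 : ℝ), ‖der u x‖ ^ 2 := by
  unfold normSqDeriv
  rw [Finset.sum_eq_single j, edge_singleEdge_self, sq_norm_eq_integral]
  · intro i _ hi
    rw [edge_singleEdge_of_ne hi, der_zero]
    simp
  · simp

theorem normPow_singleEdge {μ : ℝ} (hμ : 0 < μ) (j : Fin N) (u : H1Half)
    (hu : HasValueAtZero u 0) :
    normPow μ (singleEdge j u hu) = ∫ x in Ioi (0 : ℝ), ‖val u x‖ ^ (2 * μ + 2) := by
  unfold normPow
  rw [Finset.sum_eq_single j, edge_singleEdge_self]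
  · intro i _ hi
    rw [edge_singleEdge_of_ne hi, val_zero]
    refine integral_eq_zero_of_ae ?_
    filter_upwards [Lp.coeFn_zero ℂ 2 (volume.restrict (Ioi (0 : ℝ)))] with x hx
    rw [hx]
    simp [Real.zero_rpow (by positivity : 2 * μ + 2 ≠ 0)]
  · simp

theorem normSq_smul (c : ℂ) (Ψ : EnergySpace N) : normSq (c • Ψ) = ‖c‖ ^ 2 * normSq Ψ := by
  unfold normSq
  rw [Finset.mul_sum]
  refine Finset.sum_congr rfl fun i _ => ?_
  rw [← mul_pow, ← norm_smul]
  rfl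

theorem normSqDeriv_smul (c : ℂ) (Ψ : EnergySpace N) :
    normSqDeriv (c • Ψ) = ‖c‖ ^ 2 * normSqDeriv Ψ := by
  unfold normSqDeriv
  rw [Finset.mul_sum]
  refine Finset.sum_congr rfl fun i _ => ?_
  rw [← mul_pow, ← norm_smul]
  rfl

theorem normPow_smul (μ : ℝ) (c : ℂ) (Ψ : EnergySpace N) :
    normPow μ (c • Ψ) = ‖c‖ ^ (2 * μ + 2) * normPow μ Ψ := by
  unfold normPow
  rw [Finset.mul_sum]
  refine Finset.sum_congr rfl fun i _ => ?_
  rw [← integral_const_mul]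
  refine integral_congr_ae ?_
  have h : val (edge (c • Ψ) i) = c • val (edge Ψ i) := rfl
  rw [h]
  filter_upwards [Lp.coeFn_smul c (val (edge Ψ i))] with x hx
  rw [hx, Pi.smul_apply, norm_smul, Real.mul_rpow (norm_nonneg _) (norm_nonneg _)]

section Scale

variable {μ ω : ℝ} {Ψ : EnergySpace N}

/-- The quadratic part scales with δ² and the nonlinear one with δ^(2μ+2), so the Nehari equation
fixes δ^(2μ) as their quotient. -/
theorem nehariScale_smul_mem_nehari (hμ : 0 < μ) (hA : 0 < normSqDeriv Ψ + ω * normSq Ψ)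
    (hB : 0 < normPow μ Ψ) : (nehariScale μ ω Ψ : ℂ) • Ψ ∈ nehari N μ ω := by
  set δ := nehariScale μ ω Ψ with hδ
  have hδ0 : 0 < δ := Real.rpow_pos_of_pos (div_pos hA hB) _
  have hδp : δ ^ (2 * μ) * normPow μ Ψ = normSqDeriv Ψ + ω * normSq Ψ := by
    rw [hδ, nehariScale, ← Real.rpow_mul (div_pos hA hB).le,
      one_div_mul_cancel (by positivity), Real.rpow_one, div_mul_cancel₀ _ hB.ne']
  have hn : ‖(δ : ℂ)‖ = δ := Complex.norm_of_nonneg hδ0.le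
  refine ⟨fun h => ?_, ?_⟩
  · have h1 : Ψ = 0 := (smul_eq_zero.1 h).resolve_left (by exact_mod_cast hδ0.ne')
    -- Homogeneity with factor 0 shows that `normPow` vanishes at 0, against `hB`.
    have h2 := normPow_smul μ (0 : ℂ) Ψ
    rw [zero_smul, ← h1, norm_zero, Real.zero_rpow (by positivity), zero_mul] at h2
    exact hB.ne' h2
  · unfold nehariFunctional
    rw [normSq_smul, normSqDeriv_smul, normPow_smul, hn, Real.rpow_add hδ0, Real.rpow_two]
    linear_combination (-(δ ^ 2)) * hδp

theorem action_smul (l : ℝ) (hl : 0 ≤ l) : action μ ω ((l : ℂ) • Ψ)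
    = 1 / 2 * l ^ 2 * (normSqDeriv Ψ + ω * normSq Ψ)
      - 1 / (2 * μ + 2) * l ^ (2 * μ + 2) * normPow μ Ψ := by
  unfold action energy mass
  rw [normSq_smul, normSqDeriv_smul, normPow_smul, Complex.norm_of_nonneg hl]
  ring

end Scale

/-- Bounded functionals on functions supported on one edge are given by a pair of `L²`
functions. -/
theorem exists_inner_representation (l : EnergySpace N →L[ℂ] ℂ) (j : Fin N) :
    ∃ a b : L2Half, ∀ (u : H1Half) (hu : HasValueAtZero u 0),
      l (singleEdge j u hu) = inner ℂ a (val u) + inner ℂ b (der u) := by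
  -- Hahn-Banach is used twice, to leave the energy space and then H¹(ℝ⁺), so that the Riesz theorem
  -- is applied only in L², with no need for the subspaces to be closed.
  obtain ⟨L, hL, -⟩ := exists_extension_norm_eq (EnergySpace N) l
  let S : H1Half →L[ℂ] H1Graph N :=
    ((PiLp.continuousLinearEquiv 2 ℂ (fun _ : Fin N => H1Half)).symm :
      (Fin N → H1Half) →L[ℂ] H1Graph N) ∘L ContinuousLinearMap.single ℂ (fun _ => H1Half) j
  obtain ⟨M, hM, -⟩ := exists_extension_norm_eq H1Half (L ∘L S)
  let E : (L2Half × L2Half) →L[ℂ] WithLp 2 (L2Half × L2Half) :=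
    (WithLp.prodContinuousLinearEquiv 2 ℂ L2Half L2Half).symm
  let a := (InnerProductSpace.toDual ℂ L2Half).symm (M ∘L E ∘L ContinuousLinearMap.inl ℂ _ _)
  let b := (InnerProductSpace.toDual ℂ L2Half).symm (M ∘L E ∘L ContinuousLinearMap.inr ℂ _ _)
  refine ⟨a, b, fun u hu => ?_⟩
  rw [InnerProductSpace.toDual_symm_apply, InnerProductSpace.toDual_symm_apply]
  have h1 : l (singleEdge j u hu) = M u := by
    rw [hM u, ← hL]
    rfl
  have h2 : (u : WithLp 2 (L2Half × L2Half)) = E (val u, 0) + E (0, der u) := by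
    rw [← map_add, Prod.mk_add_mk, add_zero, zero_add]
    rfl
  rw [h1, h2, map_add]
  rfl

end H1

/-! ### Limits of norms and pairings for escaping solitons -/

/-- The soliton centred at `n`, multiplied by `η`. -/
noncomputable def cutSoliton (μ ω : ℝ) (η : ℝ → ℝ) (n : ℕ) (x : ℝ) : ℝ :=
  soliton μ ω (x - n) * η x

section CutSoliton

variable {μ ω K : ℝ} {η : ℝ → ℝ}

theorem contDiff_cutSoliton (hμ : 0 < μ) (hη : ContDiff ℝ 1 η) (n : ℕ) :
    ContDiff ℝ 1 (cutSoliton μ ω η n) :=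
  ((contDiff_soliton hμ).comp (contDiff_id.sub contDiff_const)).mul hη

theorem deriv_cutSoliton (hμ : 0 < μ) (hη : ContDiff ℝ 1 η) (n : ℕ) (x : ℝ) :
    deriv (cutSoliton μ ω η n) x
      = deriv (soliton μ ω) (x - n) * η x + soliton μ ω (x - n) * deriv η x := by
  have h1 : HasDerivAt (fun x => soliton μ ω (x - n)) (deriv (soliton μ ω) (x - n)) x :=
    (hasDerivAt_soliton hμ (x - n)).differentiableAt.hasDerivAt.comp_sub_const x n
  have h2 : HasDerivAt η (deriv η x) x := ((hη.differentiable one_ne_zero) x).hasDerivAt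
  exact (h1.mul h2).deriv

theorem abs_cutSoliton_le (hμ : 0 < μ) (hω : 0 < ω) (h01 : ∀ x, 0 ≤ η x ∧ η x ≤ 1) (n : ℕ)
    (x : ℝ) : |cutSoliton μ ω η n x| ≤ soliton μ ω (x - n) := by
  unfold cutSoliton
  rw [abs_of_nonneg (mul_nonneg (soliton_pos hμ hω _).le (h01 x).1)]
  exact mul_le_of_le_one_right (soliton_pos hμ hω _).le (h01 x).2

theorem abs_deriv_cutSoliton_le (hμ : 0 < μ) (hω : 0 < ω) (hη : ContDiff ℝ 1 η)
    (h01 : ∀ x, 0 ≤ η x ∧ η x ≤ 1) (hK : ∀ x, |deriv η x| ≤ K) (n : ℕ) (x : ℝ) :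
    |deriv (cutSoliton μ ω η n) x| ≤ (√ω + K) * soliton μ ω (x - n) := by
  rw [deriv_cutSoliton hμ hη]
  refine (abs_add_le _ _).trans ?_
  have hs := (soliton_pos hμ hω (x - n)).le
  rw [abs_mul, abs_mul, abs_of_nonneg (h01 x).1, abs_of_nonneg hs, add_mul]
  refine add_le_add ?_ ?_
  · exact (mul_le_of_le_one_right (abs_nonneg _) (h01 x).2).trans (abs_deriv_soliton_le hμ hω _)
  · rw [mul_comm K]
    exact mul_le_mul_of_nonneg_left (hK x) hs

theorem memLp_ofReal_of_abs_le_soliton (hμ : 0 < μ) (hω : 0 < ω) {w : ℝ → ℝ} (hw : Continuous w)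
    {C : ℝ} (n : ℕ) (h : ∀ x, |w x| ≤ C * soliton μ ω (x - n)) :
    MemLp (fun x => (w x : ℂ)) 2 (volume.restrict (Ioi (0 : ℝ))) := by
  have hs : MemLp (fun x => soliton μ ω (x - n)) 2 volume :=
    (memLp_two_iff_integrable_sq ((continuous_soliton hμ).comp
      (continuous_id.sub continuous_const)).aestronglyMeasurable).2
      ((integrable_soliton_sq hμ hω).comp_sub_right (n : ℝ))
  refine (hs.of_le_mul (c := C) (Complex.continuous_ofReal.comp hw).aestronglyMeasurable
    (ae_of_all _ fun x => ?_)).restrict _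
  rw [Function.comp_apply, Complex.norm_real, Real.norm_eq_abs,
    Real.norm_of_nonneg (soliton_pos hμ hω _).le]
  exact h x

theorem tendsto_add_natCast (y : ℝ) : Tendsto (fun n : ℕ => y + (n : ℝ)) atTop atTop :=
  tendsto_atTop_add_const_left _ y tendsto_natCast_atTop_atTop

theorem setIntegral_Ioi_eq_integral_add {f : ℝ → ℝ} (h : ∀ x, x ≤ 0 → f x = 0) (n : ℕ) :
    ∫ x in Ioi (0 : ℝ), f x = ∫ y, f (y + n) := by
  rw [integral_add_right_eq_self f (n : ℝ)]
  exact setIntegral_eq_integral_of_forall_compl_eq_zero fun x hx => h x (not_lt.1 hx)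

theorem cutSoliton_add (n : ℕ) (y : ℝ) :
    cutSoliton μ ω η n (y + n) = soliton μ ω y * η (y + n) := by
  simp [cutSoliton]

/-- In coordinates centred at the soliton, the cutoff equals 1 at any given y as soon as y + n ≥ 2,
and the full soliton dominates. A real exponent p serves both the mass and the nonlinear term. -/
theorem tendsto_integral_cutSoliton_rpow (hμ : 0 < μ) (hω : 0 < ω) (hη : ContDiff ℝ 1 η)
    (h01 : ∀ x, 0 ≤ η x ∧ η x ≤ 1) (h0 : ∀ x, x ≤ 1 → η x = 0) (h1 : ∀ x, 2 ≤ x → η x = 1)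
    {p : ℝ} (hp : 0 < p) (hi : Integrable fun x => soliton μ ω x ^ p) :
    Tendsto (fun n => ∫ x in Ioi (0 : ℝ), |cutSoliton μ ω η n x| ^ p) atTop
      (𝓝 (∫ x, soliton μ ω x ^ p)) := by
  have e : ∀ n, ∫ x in Ioi (0 : ℝ), |cutSoliton μ ω η n x| ^ p
      = ∫ y, |soliton μ ω y * η (y + n)| ^ p := fun n => by
    rw [setIntegral_Ioi_eq_integral_add (fun x hx => ?_) n]
    · simp_rw [cutSoliton_add]
    · rw [cutSoliton, h0 x (by linarith), mul_zero, abs_zero, Real.zero_rpow hp.ne']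
  simp_rw [e]
  refine tendsto_integral_of_dominated_convergence (fun x => soliton μ ω x ^ p) ?_ hi ?_ ?_
  · intro n
    exact ((((continuous_soliton hμ).mul (hη.continuous.comp
      (continuous_id.add continuous_const))).abs).rpow_const
        fun _ => Or.inr hp.le).aestronglyMeasurable
  · refine fun n => ae_of_all _ fun y => ?_
    rw [Real.norm_of_nonneg (Real.rpow_nonneg (abs_nonneg _) _),
      abs_of_nonneg (mul_nonneg (soliton_pos hμ hω y).le (h01 _).1)]
    exact Real.rpow_le_rpow (mul_nonneg (soliton_pos hμ hω y).le (h01 _).1)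
      (mul_le_of_le_one_right (soliton_pos hμ hω _).le (h01 _).2) hp.le
  · refine ae_of_all _ fun y => tendsto_const_nhds.congr' ?_
    filter_upwards [(tendsto_add_natCast y).eventually_ge_atTop 2] with n hn
    rw [h1 _ hn, mul_one, abs_of_pos (soliton_pos hμ hω y)]

/-- The extra term carrying the derivative of the cutoff lives at y + n ≤ 2, so it disappears
pointwise. Domination uses that the derivative of the cut soliton is at most √ω + K times the
soliton. -/
theorem tendsto_integral_deriv_cutSoliton_sq (hμ : 0 < μ) (hω : 0 < ω) (hη : ContDiff ℝ 1 η)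
    (h01 : ∀ x, 0 ≤ η x ∧ η x ≤ 1) (h0 : ∀ x, x ≤ 1 → η x = 0) (h1 : ∀ x, 2 ≤ x → η x = 1)
    (hK : ∀ x, |deriv η x| ≤ K) (hd : ∀ x, 2 < x → deriv η x = 0) :
    Tendsto (fun n => ∫ x in Ioi (0 : ℝ), |deriv (cutSoliton μ ω η n) x| ^ 2) atTop
      (𝓝 (∫ x, deriv (soliton μ ω) x ^ 2)) := by
  have hd0 : ∀ n x, x ≤ 0 → deriv (cutSoliton μ ω η n) x = 0 := fun n x hx => by
    have : cutSoliton μ ω η n =ᶠ[𝓝 x] fun _ => 0 := by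
      filter_upwards [Iio_mem_nhds (show x < 1 by linarith)] with y hy
      rw [cutSoliton, h0 y (le_of_lt hy), mul_zero]
    rw [this.deriv_eq, deriv_const]
  have e : ∀ n, ∫ x in Ioi (0 : ℝ), |deriv (cutSoliton μ ω η n) x| ^ 2
      = ∫ y, |deriv (cutSoliton μ ω η n) (y + n)| ^ 2 := fun n =>
    setIntegral_Ioi_eq_integral_add (f := fun x => |deriv (cutSoliton μ ω η n) x| ^ 2)
      (fun x hx => by simp [hd0 n x hx]) n
  simp_rw [e]
  refine tendsto_integral_of_dominated_convergence
    (fun x => (√ω + K) ^ 2 * soliton μ ω x ^ 2) ?_ ((integrable_soliton_sq hμ hω).const_mul _) ?_ ?_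
  · intro n
    exact ((((contDiff_cutSoliton hμ hη n).continuous_deriv le_rfl).comp
      (continuous_id.add continuous_const)).abs.pow 2).aestronglyMeasurable
  · refine fun n => ae_of_all _ fun y => ?_
    rw [Real.norm_of_nonneg (by positivity), ← mul_pow]
    have h := abs_deriv_cutSoliton_le hμ hω hη h01 hK n (y + n)
    rw [add_sub_cancel_right] at h
    gcongr
  · refine ae_of_all _ fun y => tendsto_const_nhds.congr' ?_
    filter_upwards [(tendsto_add_natCast y).eventually_gt_atTop 2] with n hn
    rw [deriv_cutSoliton hμ hη, h1 _ hn.le, hd _ hn, add_sub_cancel_right, mul_one, mul_zero,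
      add_zero, sq_abs]

/-- Translates of the soliton escaping to infinity are asymptotically orthogonal to every `L²`
function. -/
theorem tendsto_integral_norm_mul_soliton (hμ : 0 < μ) (hω : 0 < ω) (a : L2Half) :
    Tendsto (fun n : ℕ => ∫ x in Ioi (0 : ℝ), ‖a x‖ * soliton μ ω (x - n)) atTop (𝓝 0) := by
  set I := ∫ x, soliton μ ω x
  have hI : 0 ≤ I := integral_nonneg fun x => (soliton_pos hμ hω x).le
  have hasq : Integrable (fun x => ‖a x‖ ^ 2) (volume.restrict (Ioi (0 : ℝ))) :=
    (Lp.memLp a).norm.integrable_sq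
  have hsc : ∀ n : ℕ, Continuous fun x => soliton μ ω (x - n) := fun n =>
    (continuous_soliton hμ).comp (continuous_id.sub continuous_const)
  -- Since `a` need not be integrable, dominated convergence is run on ‖a‖², with the peak bounding
  -- the soliton; the first power is recovered below by Young's inequality with parameter ε.
  have hX : Tendsto (fun n : ℕ => ∫ x in Ioi (0 : ℝ), ‖a x‖ ^ 2 * soliton μ ω (x - n)) atTop
      (𝓝 0) := by
    have h0 : ∫ x in Ioi (0 : ℝ), ‖a x‖ ^ 2 * (0 : ℝ) = 0 := by simp
    refine Tendsto.mono_right ?_ (congrArg 𝓝 h0).le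
    refine tendsto_integral_of_dominated_convergence (fun x => ‖a x‖ ^ 2 * peak μ ω) ?_
      (hasq.mul_const _) ?_ ?_
    · exact fun n => hasq.1.mul (hsc n).aestronglyMeasurable
    · refine fun n => ae_of_all _ fun x => ?_
      rw [Real.norm_of_nonneg (mul_nonneg (sq_nonneg _) (soliton_pos hμ hω _).le)]
      exact mul_le_mul_of_nonneg_left (soliton_le_peak hμ hω _) (sq_nonneg _)
    · refine ae_of_all _ fun x => Tendsto.const_mul _ ((tendsto_soliton_atBot hμ hω).comp ?_)
      have := tendsto_neg_atTop_atBot.comp (tendsto_add_natCast (-x))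
      refine this.congr fun n => ?_
      simp only [Function.comp_apply]
      ring
  have hXi : ∀ n : ℕ, Integrable (fun x => ‖a x‖ ^ 2 * soliton μ ω (x - n))
      (volume.restrict (Ioi (0 : ℝ))) := fun n => by
    refine Integrable.mono' (hasq.mul_const (peak μ ω))
      (hasq.1.mul (hsc n).aestronglyMeasurable) (ae_of_all _ fun x => ?_)
    rw [Real.norm_of_nonneg (mul_nonneg (sq_nonneg _) (soliton_pos hμ hω _).le)]
    exact mul_le_mul_of_nonneg_left (soliton_le_peak hμ hω _) (sq_nonneg _)
  have hsi : ∀ n : ℕ, Integrable fun x => soliton μ ω (x - n) := fun n =>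
    (integrable_soliton hμ hω).comp_sub_right (n : ℝ)
  have hsI : ∀ n : ℕ, ∫ x in Ioi (0 : ℝ), soliton μ ω (x - n) ≤ I := fun n => by
    refine (setIntegral_le_integral (hsi n) (ae_of_all _ fun x => (soliton_pos hμ hω _).le)).trans_eq
      ?_
    exact integral_sub_right_eq_self (soliton μ ω) (n : ℝ)
  refine tendsto_order.2 ⟨fun r hr => Eventually.of_forall fun n => hr.trans_le ?_, fun r hr => ?_⟩
  · exact integral_nonneg fun x => mul_nonneg (norm_nonneg _) (soliton_pos hμ hω _).le
  · set ε := r / (I + 1) with hε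
    have hε0 : 0 < ε := by positivity
    have hεI : ε * I < r := by
      rw [hε, div_mul_eq_mul_div, div_lt_iff₀ (by positivity)]
      nlinarith
    filter_upwards [hX.eventually (gt_mem_nhds (show 0 < ε * r by positivity))] with n hn
    have hle : ∫ x in Ioi (0 : ℝ), ‖a x‖ * soliton μ ω (x - n)
        ≤ ∫ x in Ioi (0 : ℝ), (1 / 2 * ε⁻¹ * (‖a x‖ ^ 2 * soliton μ ω (x - n))
          + 1 / 2 * ε * soliton μ ω (x - n)) := by
      refine integral_mono_of_nonneg
        (ae_of_all _ fun x => mul_nonneg (norm_nonneg _) (soliton_pos hμ hω _).le)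
        (((hXi n).const_mul _).add ((hsi n).restrict.const_mul _)) (ae_of_all _ fun x => ?_)
      have h1 : ‖a x‖ ≤ 1 / 2 * ε⁻¹ * ‖a x‖ ^ 2 + 1 / 2 * ε := by
        have h2 : 0 ≤ (‖a x‖ - ε) ^ 2 := sq_nonneg _
        have h3 : 1 / 2 * ε⁻¹ * ‖a x‖ ^ 2 + 1 / 2 * ε - ‖a x‖
            = 1 / 2 * ε⁻¹ * (‖a x‖ - ε) ^ 2 := by field_simp; ring
        have h4 : 0 ≤ 1 / 2 * ε⁻¹ * (‖a x‖ - ε) ^ 2 := by positivity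
        linarith
      refine (mul_le_mul_of_nonneg_right h1 (soliton_pos hμ hω (x - n)).le).trans_eq ?_
      ring
    rw [integral_add ((hXi n).const_mul _) ((hsi n).restrict.const_mul _), integral_const_mul,
      integral_const_mul] at hle
    have h5 : 1 / 2 * ε⁻¹ * ∫ x in Ioi (0 : ℝ), ‖a x‖ ^ 2 * soliton μ ω (x - n) < r / 2 := by
      calc _ < 1 / 2 * ε⁻¹ * (ε * r) := by gcongr
        _ = r / 2 := by field_simp
    have h6 : 1 / 2 * ε * ∫ x in Ioi (0 : ℝ), soliton μ ω (x - n) ≤ 1 / 2 * ε * I := by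
      have := hsI n
      gcongr
    linarith

theorem norm_inner_le_of_norm_le_soliton (hμ : 0 < μ) (hω : 0 < ω) (a u : L2Half) {C : ℝ} (n : ℕ)
    (hu : ∀ᵐ x ∂volume.restrict (Ioi (0 : ℝ)), ‖u x‖ ≤ C * soliton μ ω (x - n)) :
    ‖(inner ℂ a u : ℂ)‖ ≤ C * ∫ x in Ioi (0 : ℝ), ‖a x‖ * soliton μ ω (x - n) := by
  have hs : MemLp (fun x => soliton μ ω (x - n)) 2 (volume.restrict (Ioi (0 : ℝ))) :=
    ((memLp_two_iff_integrable_sq ((continuous_soliton hμ).comp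
      (continuous_id.sub continuous_const)).aestronglyMeasurable).2
      ((integrable_soliton_sq hμ hω).comp_sub_right (n : ℝ))).restrict _
  have hi : Integrable (fun x => ‖a x‖ * soliton μ ω (x - n)) (volume.restrict (Ioi (0 : ℝ))) :=
    (Lp.memLp a).norm.integrable_mul hs
  rw [L2.inner_def, ← integral_const_mul]
  refine norm_integral_le_of_norm_le (hi.const_mul C) ?_
  filter_upwards [hu] with x hx
  refine (norm_inner_le_norm _ _).trans ?_
  calc ‖a x‖ * ‖u x‖ ≤ ‖a x‖ * (C * soliton μ ω (x - n)) := by gcongr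
    _ = _ := by ring

end CutSoliton

/-! ### The minimizing sequence and the infimum -/

/-- Solitons escaping to infinity along one edge form, after rescaling to the Nehari manifold, a
minimizing sequence that converges weakly to zero. -/
theorem exists_minimizing_sequence {N : ℕ} {μ ω : ℝ} (hμ : 0 < μ) (hω : 0 < ω) {χ : ℝ → ℝ}
    (hχ : IsCutoff χ) (j : Fin N) :
    ∃ Φ : ℕ → EnergySpace N,
      (∀ n, IsCutoffSoliton μ ω χ j n (Φ n)) ∧
      (∀ n, (nehariScale μ ω (Φ n) : ℂ) • Φ n ∈ nehari N μ ω) ∧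
      Tendsto (fun n => nehariScale μ ω (Φ n)) atTop (𝓝 1) ∧
      Tendsto (fun n => action μ ω ((nehariScale μ ω (Φ n) : ℂ) • Φ n)) atTop (𝓝 (d0 μ ω)) ∧
      ∀ l : EnergySpace N →L[ℂ] ℂ,
        Tendsto (fun n => l ((nehariScale μ ω (Φ n) : ℂ) • Φ n)) atTop (𝓝 0) := by
  obtain ⟨η, K, hη, h01, h0, h1, heq, hK, hd⟩ := hχ.exists_extension
  set w : ℕ → ℝ → ℝ := cutSoliton μ ω η with hwdef
  have hw : ∀ n, ContDiff ℝ 1 (w n) := contDiff_cutSoliton hμ hη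
  have hwb : ∀ n x, |w n x| ≤ 1 * soliton μ ω (x - n) := fun n x => by
    rw [one_mul]
    exact abs_cutSoliton_le hμ hω h01 n x
  have hwb' := abs_deriv_cutSoliton_le hμ hω hη h01 hK
  choose u hu hu' using fun n => exists_H1Half_of_contDiff (hw n)
    (memLp_ofReal_of_abs_le_soliton hμ hω (hw n).continuous n (hwb n))
    (memLp_ofReal_of_abs_le_soliton hμ hω ((hw n).continuous_deriv le_rfl) n (hwb' n))
  have hu0 : ∀ n, HasValueAtZero (u n) 0 := fun n =>
    ⟨fun x => (w n x : ℂ), (Complex.continuous_ofReal.comp (hw n).continuous).continuousOn, hu n,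
      by simp [hwdef, cutSoliton, h0 0 zero_le_one]⟩
  set Φ : ℕ → EnergySpace N := fun n => singleEdge j (u n) (hu0 n) with hΦ
  have hM : ∀ n, normSq (Φ n) = ∫ x in Ioi (0 : ℝ), |w n x| ^ (2 : ℝ) := fun n => by
    rw [hΦ, normSq_singleEdge]
    refine integral_congr_ae ?_
    filter_upwards [hu n] with x hx
    rw [hx, Complex.norm_real, Real.norm_eq_abs, Real.rpow_two]
  have hA : ∀ n, normSqDeriv (Φ n) = ∫ x in Ioi (0 : ℝ), |deriv (w n) x| ^ 2 := fun n => by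
    rw [hΦ, normSqDeriv_singleEdge]
    refine integral_congr_ae ?_
    filter_upwards [hu' n] with x hx
    rw [hx, Complex.norm_real, Real.norm_eq_abs]
  have hB : ∀ n, normPow μ (Φ n) = ∫ x in Ioi (0 : ℝ), |w n x| ^ (2 * μ + 2) := fun n => by
    rw [hΦ, normPow_singleEdge hμ]
    refine integral_congr_ae ?_
    filter_upwards [hu n] with x hx
    rw [hx, Complex.norm_real, Real.norm_eq_abs]
  have hpos : ∀ n {p : ℝ}, 0 < p → (Integrable fun x => soliton μ ω x ^ p) →
      0 < ∫ x in Ioi (0 : ℝ), |w n x| ^ p := by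
    intro n p hp hi
    have hc : Continuous fun x => |w n x| ^ p :=
      (hw n).continuous.abs.rpow_const fun _ => Or.inr hp.le
    have hint : IntegrableOn (fun x => |w n x| ^ p) (Ioi 0) := by
      refine Integrable.mono' (hi.comp_sub_right (n : ℝ)).restrict hc.aestronglyMeasurable
        (ae_of_all _ fun x => ?_)
      rw [Real.norm_of_nonneg (Real.rpow_nonneg (abs_nonneg _) _)]
      refine Real.rpow_le_rpow (abs_nonneg _) ((hwb n x).trans_eq (one_mul _)) hp.le
    rw [setIntegral_pos_iff_support_of_nonneg_ae
      (ae_of_all _ fun x => Real.rpow_nonneg (abs_nonneg _) _) hint]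
    -- On (2, 3) the cutoff is 1 for every n, so the cut soliton is positive on a set of positive
    -- measure.
    have hsub : Ioo (2 : ℝ) 3 ⊆ (Function.support fun x => |w n x| ^ p) ∩ Ioi 0 := by
      intro x hx
      refine ⟨?_, by have := hx.1; simp only [mem_Ioi]; linarith⟩
      have : 0 < w n x := by
        simp only [hwdef, cutSoliton]
        rw [h1 x hx.1.le, mul_one]
        exact soliton_pos hμ hω _
      exact (Real.rpow_pos_of_pos (abs_pos.2 this.ne') _).ne'
    refine lt_of_lt_of_le ?_ (measure_mono hsub)
    rw [Real.volume_Ioo]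
    norm_num
  have hi2 : Integrable fun x => soliton μ ω x ^ (2 : ℝ) := by
    simp_rw [Real.rpow_two]
    exact integrable_soliton_sq hμ hω
  have hip := integrable_soliton_rpow hμ hω
  have hp : 0 < 2 * μ + 2 := by positivity
  have hB0 : ∀ n, 0 < normPow μ (Φ n) := fun n => by
    rw [hB]
    exact hpos n hp hip
  have hA0 : ∀ n, 0 < normSqDeriv (Φ n) + ω * normSq (Φ n) := fun n => by
    have h2 : 0 < normSq (Φ n) := by
      rw [hM]
      exact hpos n two_pos hi2
    have h3 : 0 ≤ normSqDeriv (Φ n) := Finset.sum_nonneg fun i _ => by positivity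
    positivity
  set D := d0 μ ω with hD
  have hD0 : 0 < D := by
    have h := integral_soliton_rpow hμ hω
    rw [integral_deriv_soliton_sq hμ hω, ← hD] at h
    have h2 : 0 < ∫ x, soliton μ ω x ^ (2 * μ + 2) := by
      refine (integral_pos_iff_support_of_nonneg
        (fun x => Real.rpow_nonneg (soliton_pos hμ hω x).le _) hip).2 ?_
      have : (Function.support fun x => soliton μ ω x ^ (2 * μ + 2)) = univ :=
        eq_univ_of_forall fun x => (Real.rpow_pos_of_pos (soliton_pos hμ hω x) _).ne'
      rw [this]
      simp
    rw [h] at h2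
    exact pos_of_mul_pos_right h2 (by positivity)
  -- The common limit of numerator and denominator in the scale, namely ∫ φ^(2μ+2) over the line;
  -- that the limits agree is the Nehari identity of the line soliton.
  set Q := 2 * (μ + 1) / μ * D with hQ
  have hQ0 : 0 < Q := by positivity
  have hBlim : Tendsto (fun n => normPow μ (Φ n)) atTop (𝓝 Q) := by
    rw [hQ, hD, ← integral_deriv_soliton_sq hμ hω, ← integral_soliton_rpow hμ hω]
    simp_rw [hB]
    exact tendsto_integral_cutSoliton_rpow hμ hω hη h01 h0 h1 hp hip
  have hAlim : Tendsto (fun n => normSqDeriv (Φ n) + ω * normSq (Φ n)) atTop (𝓝 Q) := by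
    have h2 : Q = (∫ x, deriv (soliton μ ω) x ^ 2) + ω * ∫ x, soliton μ ω x ^ (2 : ℝ) := by
      simp_rw [Real.rpow_two]
      rw [integral_soliton_sq hμ hω, integral_deriv_soliton_sq hμ hω, hQ, hD]
      field_simp
      ring
    rw [h2]
    simp_rw [hA, hM]
    exact (tendsto_integral_deriv_cutSoliton_sq hμ hω hη h01 h0 h1 hK hd).add
      ((tendsto_integral_cutSoliton_rpow hμ hω hη h01 h0 h1 two_pos hi2).const_mul ω)
  have hδ : Tendsto (fun n => nehariScale μ ω (Φ n)) atTop (𝓝 1) := by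
    have h2 := (hAlim.div hBlim hQ0.ne').rpow_const (p := 1 / (2 * μ)) (Or.inr (by positivity))
    rwa [div_self hQ0.ne', Real.one_rpow] at h2
  have hδ0 : ∀ n, 0 ≤ nehariScale μ ω (Φ n) := fun n =>
    Real.rpow_nonneg (div_pos (hA0 n) (hB0 n)).le _
  refine ⟨Φ, fun n i => ?_, fun n => nehariScale_smul_mem_nehari hμ (hA0 n) (hB0 n), hδ, ?_, ?_⟩
  · rcases eq_or_ne i j with rfl | hij
    · rw [hΦ, edge_singleEdge_self]
      filter_upwards [hu n, ae_restrict_mem measurableSet_Ioi] with x hx hx0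
      rw [hx, if_pos rfl]
      simp only [hwdef, cutSoliton]
      rw [heq x hx0]
    · simp only [if_neg hij]
      rw [hΦ, edge_singleEdge_of_ne hij, val_zero]
      exact Lp.coeFn_zero _ _ _
  · simp_rw [fun n => action_smul (μ := μ) (ω := ω) (Ψ := Φ n) _ (hδ0 n)]
    have h2 := (((hδ.pow 2).const_mul (1 / 2)).mul hAlim).sub
      (((hδ.rpow_const (p := 2 * μ + 2) (Or.inr hp.le)).const_mul (1 / (2 * μ + 2))).mul hBlim)
    have h3 : 1 / 2 * 1 ^ 2 * Q - 1 / (2 * μ + 2) * 1 ^ (2 * μ + 2) * Q = D := by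
      rw [Real.one_rpow, hQ]
      field_simp
      ring
    rwa [h3] at h2
  · intro l
    obtain ⟨a, b, hab⟩ := exists_inner_representation l j
    have hl : Tendsto (fun n => l (Φ n)) atTop (𝓝 0) := by
      have ha := (tendsto_integral_norm_mul_soliton hμ hω a).const_mul 1
      have hb := (tendsto_integral_norm_mul_soliton hμ hω b).const_mul (√ω + K)
      have hsum := ha.add hb
      rw [mul_zero, mul_zero, add_zero] at hsum
      refine squeeze_zero_norm (fun n => ?_) hsum
      rw [hΦ, hab]
      refine (norm_add_le _ _).trans (add_le_add ?_ ?_)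
      · refine norm_inner_le_of_norm_le_soliton hμ hω a _ n ?_
        filter_upwards [hu n] with x hx
        rw [hx, Complex.norm_real]
        exact hwb n x
      · refine norm_inner_le_of_norm_le_soliton hμ hω b _ n ?_
        filter_upwards [hu' n] with x hx
        rw [hx, Complex.norm_real]
        exact hwb' n x
    have h2 := ((Complex.continuous_ofReal.tendsto 1).comp hδ).mul hl
    rw [mul_zero] at h2
    refine h2.congr fun n => ?_
    rw [map_smul, smul_eq_mul]
    rfl

theorem exists_isCutoff : ∃ χ : ℝ → ℝ, IsCutoff χ := by
  refine ⟨fun x => Real.smoothTransition (x - 1), ?_, ?_, ?_, ?_⟩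
  · exact (Real.smoothTransition.contDiff.comp (contDiff_id.sub contDiff_const)).contDiffOn
  · exact fun x _ => ⟨Real.smoothTransition.nonneg _, Real.smoothTransition.le_one _⟩
  · exact fun x _ hx => Real.smoothTransition.zero_of_nonpos (by linarith)
  · exact fun x hx => Real.smoothTransition.one_of_one_le (by linarith)

/-- The infimum of the action on the Nehari manifold. -/
theorem isGLB_action_nehari {N : ℕ} (hN : 2 ≤ N) {μ ω : ℝ} (hμ : 0 < μ) (hω : 0 < ω) :
    IsGLB (action μ ω '' nehari N μ ω) (d0 μ ω) := by
  refine ⟨?_, fun b hb => ?_⟩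
  · rintro _ ⟨Ψ, hΨ, rfl⟩
    rw [← two_mul_primitive_peak hμ hω]
    exact two_mul_primitive_le_action hN hμ hω hΨ
  · obtain ⟨χ, hχ⟩ := exists_isCutoff
    obtain ⟨Φ, -, h1, -, h2, -⟩ := exists_minimizing_sequence hμ hω hχ (⟨0, by omega⟩ : Fin N)
    exact ge_of_tendsto' h2 fun n => hb ⟨_, h1 n, rfl⟩

end StarGraph

theorem theorem3p1 (N : ℕ) (hN : 2 ≤ N) (μ ω : ℝ) (hμ : 0 < μ) (hω : 0 < ω) :
    -- the infimum of the action on the Nehari manifold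
    IsGLB (StarGraph.action μ ω '' StarGraph.nehari N μ ω) (StarGraph.d0 μ ω) ∧
    -- it is the action of the soliton on the line
    (ContDiff ℝ 1 (StarGraph.soliton μ ω) ∧
      MemLp (StarGraph.soliton μ ω) 2 volume ∧
      MemLp (deriv (StarGraph.soliton μ ω)) 2 volume ∧
      MemLp (StarGraph.soliton μ ω) (ENNReal.ofReal (2 * μ + 2)) volume ∧
      StarGraph.lineAction μ ω (StarGraph.soliton μ ω) = StarGraph.d0 μ ω) ∧
    -- solitons escaping to infinity along one edge, rescaled to the Nehari manifold,
    -- form a minimizing sequence that converges weakly to zero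
    ∀ (χ : ℝ → ℝ), StarGraph.IsCutoff χ → ∀ j : Fin N,
      ∃ Φ : ℕ → StarGraph.EnergySpace N,
        (∀ n, StarGraph.IsCutoffSoliton μ ω χ j n (Φ n)) ∧
        (∀ n, (StarGraph.nehariScale μ ω (Φ n) : ℂ) • Φ n ∈ StarGraph.nehari N μ ω) ∧
        Tendsto (fun n => StarGraph.nehariScale μ ω (Φ n)) atTop (𝓝 1) ∧
        Tendsto (fun n => StarGraph.action μ ω ((StarGraph.nehariScale μ ω (Φ n) : ℂ) • Φ n))
          atTop (𝓝 (StarGraph.d0 μ ω)) ∧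
        ∀ l : StarGraph.EnergySpace N →L[ℂ] ℂ,
          Tendsto (fun n => l ((StarGraph.nehariScale μ ω (Φ n) : ℂ) • Φ n)) atTop (𝓝 0) := by
  refine ⟨StarGraph.isGLB_action_nehari hN hμ hω, ⟨StarGraph.contDiff_soliton hμ,
    StarGraph.memLp_soliton hμ hω, StarGraph.memLp_deriv_soliton hμ hω,
    StarGraph.memLp_soliton_rpow hμ hω, StarGraph.lineAction_soliton hμ hω⟩, fun χ hχ j =>
    StarGraph.exists_minimizing_sequence hμ hω hχ j⟩
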